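/- For a full-rank lattice $\mathcal L\subseteq\mathbb Z^n$ let $\lambda_1(\mathcal L)$ be the minimum of $\|v\|_1$ over nonzero $v\in\mathcal L$, and let $d_1(x,y)=\|x-y\|_1$, $d_1(r,\mathcal L)=\inf_{v\in\mathcal L}d_1(r,v)$. For $x\in\mathbb Z_q^n$, with coordinates represented in $\{0,\dots,q-1\}$, the Lee weight is $\mathrm{wt}_L(x)=\sum_i\min\{x_i,\,q-x_i\}$, and $d_L(x,y)=\mathrm{wt}_L(x-y)$. $\mathsf{BDD}_\alpha$: given a lattice $\mathcal L\subseteq \mathbb Z^n$ and $r\in\mathbb Z^n$ with $d_1(r,\mathcal L)<\alpha\lambda_1(\mathcal L)$, find $v\in\mathcal L$ with $d_1(v,r)<\alpha\lambda_1(\mathcal L)$. $\mathsf{LeeDP}_t$: given a linear code $\mathcal C\subseteq\mathbb Z_q^n$ (by a generator matrix) and $r\in\mathbb Z_q^n$ such that some codeword $c$ satisfies $d_L(r,c)\le t$, find such a codeword. $\mathsf{LeeDP}^{<}_t$ is the same problem with $<t$ in place of $\le t$. The real number $t$ is a parameter of the problem and is not part of the input. **Theorem.** There is a polynomial-time algorithm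 which, given a matrix $B\in\mathbb Z^{n\times n}$ whose rows form a basis of a full-rank lattice $\mathcal L\subseteq\mathbb Z^n$ and a vector $r\in\mathbb Z^n$, outputs $q=|\det B|$, the code $\mathcal C\subseteq\mathbb Z_q^n$ generated by the rows of $B$ modulo $q$, and a word $\check r\in\mathbb Z_q^n$, and there is a polynomial-time algorithm which, given $B$, $r$ and a word $\check c\in\mathbb Z_q^n$, outputs a vector $v\in\mathbb Z^n$, such that for every real $\alpha\in(0,1)$ and every $\mathcal L$ with basis $B$ as above, with $t=\alpha\lambda_1(\mathcal L)$: 1. These algorithms reduce $\mathsf{BDD}_\alpha$ on $\mathcal L$ to $\mathsf{LeeDP}^{<}_t$ on $\mathcal C$: if $d_1(r,\mathcal L)<\alpha\lambda_1(\mathcal L)$, then $(\mathcal C,\check r)$ is an admissible instance of $\mathsf{LeeDP}^{<}_t$, and for every solution $\check c$ of it the output $v$ is a solution of $\mathsf{BDD}_\alpha$ for $(\mathcal L,r)$. 2. If $\alpha\le\frac12$ or $t\notin\mathbb Z$, then in the same sense they also reduce $\mathsf{BDD}_\alpha$ on $\mathcal L$ to $\mathsf{LeeDP}_t$ on $\mathcal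 C$. Polynomial time is measured in bit operations, as a function of the bit length of the input. -/

import Mathlib

/-! ### A machine model with logarithmic (bit) cost

Structured random access programs over the integers. The memory consists of arrays, numbered by
natural numbers, whose cells are indexed by integers and hold integers. Every operation is charged
at least the bit lengths of the integers it handles (the logarithmic cost criterion), so that
polynomial time means the same as for Turing machines. -/

/-- Number of binary digits of `|x|`. -/
def bitLen (x : ℤ) : ℕ := Nat.size x.natAbs

/-- Memory: cell `i` of array `a` holds the integer `s a i`. -/
abbrev Memory : Type := ℕ → ℤ → ℤ

/-- Arithmetic terms; `read a i` is the content of cell `i` of array `a`. -/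
inductive Arith : Type
  | const (c : ℤ)
  | read (a : ℕ) (i : Arith)
  | plus (e f : Arith)
  | minus (e f : Arith)
  | times (e f : Arith)
  | quot (e f : Arith)

/-- Value of a term; `quot` is integer division with remainder (and gives `0` for divisor `0`). -/
def Arith.eval (s : Memory) : Arith → ℤ
  | .const c => c
  | .read a i => s a (i.eval s)
  | .plus e f => e.eval s + f.eval s
  | .minus e f => e.eval s - f.eval s
  | .times e f => e.eval s * f.eval s
  | .quot e f => e.eval s / f.eval s

/-- Bit cost of evaluating a term: linear for memory access, addition and subtraction, and
quadratic for multiplication and division. -/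
def Arith.cost (s : Memory) : Arith → ℕ
  | .const c => 1 + bitLen c
  | .read a i => i.cost s + (1 + bitLen (i.eval s) + bitLen (s a (i.eval s)))
  | .plus e f => e.cost s + f.cost s + (1 + bitLen (e.eval s) + bitLen (f.eval s))
  | .minus e f => e.cost s + f.cost s + (1 + bitLen (e.eval s) + bitLen (f.eval s))
  | .times e f => e.cost s + f.cost s + (1 + bitLen (e.eval s)) * (1 + bitLen (f.eval s))
  | .quot e f => e.cost s + f.cost s + (1 + bitLen (e.eval s)) * (1 + bitLen (f.eval s))

/-- Programs. `write a i e` stores `e` in cell `i` of array `a`; the tests of `ifPos` and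
`whilePos` are `0 < e`. -/
inductive Prog : Type
  | skip
  | write (a : ℕ) (i e : Arith)
  | seq (p p' : Prog)
  | ifPos (e : Arith) (p p' : Prog)
  | whilePos (e : Arith) (p : Prog)

/-- The memory `s` after storing `x` in cell `i` of array `a`. -/
def Memory.store (s : Memory) (a : ℕ) (i x : ℤ) : Memory :=
  fun b j => if b = a ∧ j = i then x else s b j

/-- `Prog.Runs p s s' t`: started in memory `s`, the program `p` halts in memory `s'` after
a computation of total cost `t`. -/
inductive Prog.Runs : Prog → Memory → Memory → ℕ → Prop
  | skip (s : Memory) : Prog.Runs .skip s s 1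
  | write (a : ℕ) (i e : Arith) (s : Memory) :
      Prog.Runs (.write a i e) s (s.store a (i.eval s) (e.eval s))
        (i.cost s + e.cost s + (1 + bitLen (i.eval s) + bitLen (e.eval s)))
  | seq {p p' : Prog} {s s' s'' : Memory} {t t' : ℕ} :
      Prog.Runs p s s' t → Prog.Runs p' s' s'' t' → Prog.Runs (.seq p p') s s'' (t + t')
  | ifPos_true {e : Arith} {p p' : Prog} {s s' : Memory} {t : ℕ} :
      0 < e.eval s → Prog.Runs p s s' t → Prog.Runs (.ifPos e p p') s s' (e.cost s + 1 + t)
  | ifPos_false {e : Arith} {p p' : Prog} {s s' : Memory} {t : ℕ} :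
      ¬ 0 < e.eval s → Prog.Runs p' s s' t → Prog.Runs (.ifPos e p p') s s' (e.cost s + 1 + t)
  | whilePos_done {e : Arith} {p : Prog} {s : Memory} :
      ¬ 0 < e.eval s → Prog.Runs (.whilePos e p) s s (e.cost s + 1)
  | whilePos_step {e : Arith} {p : Prog} {s s' s'' : Memory} {t t' : ℕ} :
      0 < e.eval s → Prog.Runs p s s' t → Prog.Runs (.whilePos e p) s' s'' t' →
      Prog.Runs (.whilePos e p) s s'' (e.cost s + 1 + t + t')

/-- Initial memory on the input list `xs`: array `0` holds the length of `xs` in cell `0` and the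
entries of `xs` in the cells `1, 2, …`; every other cell is zero. -/
def initMemory (xs : List ℤ) : Memory := fun a i =>
  if a = 0 then
    if i = 0 then (xs.length : ℤ) else if 0 < i then xs.getD (i.toNat - 1) 0 else 0
  else 0

/-- The output list `ys` can be read off from array `1`, in the same format as the input. -/
def HasOutput (s : Memory) (ys : List ℤ) : Prop :=
  s 1 0 = (ys.length : ℤ) ∧ ∀ i : ℕ, i < ys.length → s 1 ((i : ℤ) + 1) = ys.getD i 0

/-- Bit size of a list of integers. -/
def bitSize (xs : List ℤ) : ℕ := (xs.map fun x => 1 + bitLen x).sum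

/-- Some program computes the map `F` (with inputs encoded by `enc`, outputs being lists of
integers) in time polynomial in the bit size of the input. -/
def PolyTimeComputable {X : Type} (enc : X → List ℤ) (F : X → List ℤ) : Prop :=
  ∃ (p : Prog) (b : Polynomial ℕ), ∀ x : X, ∃ (s : Memory) (t : ℕ),
    p.Runs (initMemory (enc x)) s t ∧ HasOutput s (F x) ∧ t ≤ b.eval (bitSize (enc x))

/-! ### Search problems and polynomial-time reductions -/

/-- The data format of a search problem: instances, candidate solutions, and their encodings. -/
structure Format where
  Inst : Type
  Sol : Inst → Type
  encInst : Inst → List ℤ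
  encSol : (x : Inst) → Sol x → List ℤ

/-- A promise search problem: which instances are admissible, and which candidates solve them. -/
structure SearchProblem (P : Format) where
  Valid : P.Inst → Prop
  IsSol : (x : P.Inst) → P.Sol x → Prop

/-- A polynomial-time reduction with one oracle query: it turns an instance `x` into a query to
the target problem, and `x` together with an answer to this query into an answer to `x`. -/
structure PolyTimeReduction (P Q : Format) where
  query : P.Inst → Q.Inst
  answer : (x : P.Inst) → Q.Sol (query x) → P.Sol x
  query_polyTime : PolyTimeComputable P.encInst fun x => Q.encInst (query x)
  answer_polyTime : PolyTimeComputable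
    (fun z : (x : P.Inst) × Q.Sol (query x) => P.encInst z.1 ++ Q.encSol (query z.1) z.2)
    fun z => P.encSol z.1 (answer z.1 z.2)

/-- `R` reduces the problem `A`, restricted to the instances in `S`, to the problem `B`: every
admissible instance of `A` is mapped to an admissible instance of `B`, and every solution of the
latter gives a solution of the former. -/
def PolyTimeReduction.ReducesOn {P Q : Format} (R : PolyTimeReduction P Q) (S : Set P.Inst)
    (A : SearchProblem P) (B : SearchProblem Q) : Prop :=
  ∀ x ∈ S, A.Valid x → B.Valid (R.query x) ∧
    ∀ y : Q.Sol (R.query x), B.IsSol (R.query x) y → A.IsSol x (R.answer x y)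

/-- List of the entries of an integer matrix, row by row. -/
def matrixEntries {k n : ℕ} (M : Matrix (Fin k) (Fin n) ℤ) : List ℤ :=
  (List.ofFn fun i => List.ofFn fun j => M i j).flatten

/-! ### Bounded distance decoding in the `ℓ₁`-norm -/

/-- A full-rank integer lattice in `ℤⁿ`, given by a basis (the rows of `basis`). -/
structure LatticeBasis where
  n : ℕ
  basis : Matrix (Fin n) (Fin n) ℤ
  linearIndependent : LinearIndependent ℝ fun i j => (basis i j : ℝ)

/-- The lattice generated by the basis. -/
def LatticeBasis.lattice (L : LatticeBasis) : Submodule ℤ (Fin L.n → ℤ) :=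
  Submodule.span ℤ (Set.range fun i => L.basis i)

/-- The `ℓ₁`-norm. -/
def l1Norm {n : ℕ} (v : Fin n → ℤ) : ℝ := ∑ i, |(v i : ℝ)|

/-- The length `λ₁` of a shortest nonzero lattice vector. -/
noncomputable def LatticeBasis.lambda1 (L : LatticeBasis) : ℝ :=
  sInf {d : ℝ | ∃ v ∈ L.lattice, v ≠ 0 ∧ d = l1Norm v}

/-- The `ℓ₁`-distance from `r` to the lattice. -/
noncomputable def LatticeBasis.dist (L : LatticeBasis) (r : Fin L.n → ℤ) : ℝ :=
  sInf {d : ℝ | ∃ v ∈ L.lattice, d = l1Norm (r - v)}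

/-- An instance of bounded distance decoding: a lattice (by a basis) and a received vector. -/
structure BDDInstance where
  L : LatticeBasis
  r : Fin L.n → ℤ

/-- Instances are encoded as `n`, the entries of the basis, the entries of `r`. -/
def bddFormat : Format where
  Inst := BDDInstance
  Sol x := Fin x.L.n → ℤ
  encInst x := (x.L.n : ℤ) :: (matrixEntries x.L.basis ++ List.ofFn x.r)
  encSol _ v := List.ofFn v

/-- `BDD_α` in the `ℓ₁`-norm: given `d₁(r, L) < α λ₁(L)`, find `v ∈ L` with
`d₁(v, r) < α λ₁(L)`. -/
noncomputable def BDD (α : ℝ) : SearchProblem bddFormat where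
  Valid x := x.L.dist x.r < α * x.L.lambda1
  IsSol x (v : Fin x.L.n → ℤ) := v ∈ x.L.lattice ∧ l1Norm (v - x.r) < α * x.L.lambda1

/-! ### Decoding in the Lee metric -/

/-- A linear code over `ℤ_q` of length `n`, given by a generator matrix with `k` rows. -/
structure LinCode where
  q : ℕ
  n : ℕ
  k : ℕ
  q_pos : 0 < q
  gen : Matrix (Fin k) (Fin n) (ZMod q)

/-- The set of codewords. -/
def LinCode.words (C : LinCode) : Submodule (ZMod C.q) (Fin C.n → ZMod C.q) :=
  Submodule.span (ZMod C.q) (Set.range fun i => C.gen i)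

/-- The Lee weight of a vector: the sum over the coordinates of `min {x, q - x}`, where
`x ∈ {0, …, q - 1}` is the standard representative. -/
def leeWeight {q n : ℕ} (x : Fin n → ZMod q) : ℕ := ∑ i, min (x i).val (q - (x i).val)

/-- An instance of Lee decoding: a code (by a generator matrix) and a received word. -/
structure LeeInstance where
  C : LinCode
  r : Fin C.n → ZMod C.q

/-- Instances are encoded as `q`, `k`, `n`, the entries of the generator matrix, the entries of `r`,
where elements of `ℤ_q` are represented by `0, …, q - 1`. The radius `t` is a parameter of the
problem and is not handed over with a query. -/
def leeFormat : Format where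
  Inst := LeeInstance
  Sol x := Fin x.C.n → ZMod x.C.q
  encInst x := (x.C.q : ℤ) :: (x.C.k : ℤ) :: (x.C.n : ℤ) ::
    (matrixEntries (x.C.gen.map fun a => (a.val : ℤ)) ++ List.ofFn fun i => ((x.r i).val : ℤ))
  encSol _ c := List.ofFn fun i => ((c i).val : ℤ)

/-- `LeeDP_t`: find a codeword at Lee distance at most `t` from `r` (on instances for which there
is one). -/
def LeeDP (t : ℝ) : SearchProblem leeFormat where
  Valid x := ∃ c ∈ x.C.words, (leeWeight (x.r - c) : ℝ) ≤ t
  IsSol x (c : Fin x.C.n → ZMod x.C.q) := c ∈ x.C.words ∧ (leeWeight (x.r - c) : ℝ) ≤ t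

/-- `LeeDP_t` with strict inequality, matching the strict inequalities in `BDD_α`: find a codeword
at Lee distance less than `t` from `r` (on instances for which there is one). -/
def LeeDPStrict (t : ℝ) : SearchProblem leeFormat where
  Valid x := ∃ c ∈ x.C.words, (leeWeight (x.r - c) : ℝ) < t
  IsSol x (c : Fin x.C.n → ZMod x.C.q) := c ∈ x.C.words ∧ (leeWeight (x.r - c) : ℝ) < t

/-! ### The code of a lattice basis -/

theorem LatticeBasis.natAbs_det_pos (L : LatticeBasis) : 0 < L.basis.det.natAbs := by
  have h : IsUnit (L.basis.map (Int.cast : ℤ → ℝ)) :=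
    Matrix.linearIndependent_rows_iff_isUnit.mp L.linearIndependent
  rw [Matrix.isUnit_iff_isUnit_det, isUnit_iff_ne_zero] at h
  refine Int.natAbs_pos.mpr fun h0 => h ?_
  have := (Int.castRingHom ℝ).map_det L.basis
  simp only [h0, map_zero] at this
  exact this.symm

/-- The code over `ℤ_q`, `q = |det B|`, generated by the rows of the basis `B` modulo `q`. -/
def LatticeBasis.code (L : LatticeBasis) : LinCode where
  q := L.basis.det.natAbs
  n := L.n
  k := L.n
  q_pos := L.natAbs_det_pos
  gen := L.basis.map fun a => (a : ZMod L.basis.det.natAbs)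

/-! ### Cost estimates for programs on memories of bounded word length -/

/-! Geometry: the adjugate identity gives `q ℤⁿ ⊆ L` for `q = |det B|` (`natAbs_det_smul_mem`), so
`L` is exactly the preimage of the code under reduction modulo `q` (Construction A;
`modVec_mem_words`, `mem_lattice_of_modVec_mem_words`). Reduction does not increase weight,
`leeWeight (w mod q) ≤ ‖w‖₁` (`leeWeight_modVec_le`), so a close lattice point yields a close
codeword. Conversely, a codeword is lifted coordinatewise to the representative nearest to `r`; the
difference then has entries of size at most `q/2`, where the two weights agree, so no distance is
lost (`l1Norm_liftAnswer_sub_le`). With strict inequalities this finishes the proof. With `≤ t`, an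
answer at distance exactly `t` must be repaired: for `α ≤ 1/2` two lattice points at distances `< t`
and `≤ t` from `r` are less than `λ₁` apart, hence equal; for `t ∉ ℤ` the integral Lee weight cannot
equal `t`.

Complexity: the only nontrivial computation is `det B`. The Faddeev–LeVerrier recursion uses loops
of length `n`, exact divisions and no pivoting (`leverrier_eq`), and its intermediate integers have
polynomially many bits (`abs_leverrier_le`). Running times come from a Hoare-style calculus,
`Prog.Ensures`: if all memory words stay within `W` bits and every loop runs at most `W` times, the
cost is at most a constant times a power of `W + 1` determined by the loop depth. Only correctness
and word bounds then remain to be checked. -/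

theorem bitLen_le_iff {x : ℤ} {W : ℕ} : bitLen x ≤ W ↔ |x| < 2 ^ W := by
  rw [bitLen, Nat.size_le, Int.abs_eq_natAbs]
  exact_mod_cast Iff.rfl

theorem abs_lt_two_pow_bitLen (x : ℤ) : |x| < 2 ^ bitLen x :=
  bitLen_le_iff.mp le_rfl

theorem bitLen_mono {x y : ℤ} (h : |x| ≤ |y|) : bitLen x ≤ bitLen y :=
  bitLen_le_iff.mpr (h.trans_lt (abs_lt_two_pow_bitLen y))

theorem bitLen_zero : bitLen 0 = 0 := rfl

theorem bitLen_natCast_le (n : ℕ) : bitLen n ≤ n := by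
  rw [bitLen_le_iff, Nat.abs_cast]
  exact_mod_cast Nat.lt_two_pow_self

theorem bitLen_add_le (x y : ℤ) : bitLen (x + y) ≤ bitLen x + bitLen y + 1 := by
  rw [bitLen_le_iff]
  have hx := abs_lt_two_pow_bitLen x
  have hy := abs_lt_two_pow_bitLen y
  have h1 : (2 : ℤ) ^ bitLen x ≤ 2 ^ (bitLen x + bitLen y) :=
    pow_le_pow_right₀ (by norm_num) (by omega)
  have h2 : (2 : ℤ) ^ bitLen y ≤ 2 ^ (bitLen x + bitLen y) :=
    pow_le_pow_right₀ (by norm_num) (by omega)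
  have := abs_add_le x y
  rw [pow_succ]
  linarith

theorem bitLen_neg (x : ℤ) : bitLen (-x) = bitLen x := by
  simp [bitLen]

theorem bitLen_sub_le (x y : ℤ) : bitLen (x - y) ≤ bitLen x + bitLen y + 1 := by
  simpa [sub_eq_add_neg, bitLen_neg] using bitLen_add_le x (-y)

theorem bitLen_mul_le (x y : ℤ) : bitLen (x * y) ≤ bitLen x + bitLen y := by
  rw [bitLen_le_iff, abs_mul, pow_add]
  exact mul_lt_mul'' (abs_lt_two_pow_bitLen x) (abs_lt_two_pow_bitLen y) (abs_nonneg x)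
    (abs_nonneg y)

theorem bitLen_ediv_le (x y : ℤ) : bitLen (x / y) ≤ bitLen x :=
  bitLen_mono (Int.abs_ediv_le_abs x y)

/-! ### Memories and terms of bounded word length -/

/-- All cells of the memory hold integers of at most `W` bits. -/
def Memory.Bounded (W : ℕ) (s : Memory) : Prop := ∀ a i, bitLen (s a i) ≤ W

theorem Memory.Bounded.store {W : ℕ} {s : Memory} (hs : s.Bounded W) (a : ℕ) (i : ℤ) {x : ℤ}
    (hx : bitLen x ≤ W) : (s.store a i x).Bounded W := by
  intro b j
  unfold Memory.store
  split_ifs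
  exacts [hx, hs b j]

@[simp] theorem Memory.store_self (s : Memory) (a : ℕ) (i x : ℤ) : s.store a i x a i = x := by
  simp [Memory.store]

theorem Memory.store_of_ne {s : Memory} {a b : ℕ} {i x : ℤ} (h : b ≠ a) :
    s.store a i x b = s b := by
  funext j
  simp [Memory.store, h]

theorem Memory.store_cell_of_ne {s : Memory} {a : ℕ} {i j x : ℤ} (h : j ≠ i) :
    s.store a i x a j = s a j := by
  simp [Memory.store, h]

/-- Word length of the value of a term, as a multiple of the word length of the memory. -/
def Arith.size : Arith → ℕ
  | .const c => bitLen c + 1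
  | .read _ i => i.size + 1
  | .plus e f => e.size + f.size + 1
  | .minus e f => e.size + f.size + 1
  | .times e f => e.size + f.size + 1
  | .quot e f => e.size + f.size + 1

/-- Cost of a term, as a multiple of the square of the word length of the memory. -/
def Arith.weight : Arith → ℕ
  | .const c => 1 + bitLen c
  | .read _ i => i.weight + (2 + i.size)
  | .plus e f => e.weight + f.weight + (1 + e.size + f.size)
  | .minus e f => e.weight + f.weight + (1 + e.size + f.size)
  | .times e f => e.weight + f.weight + (1 + e.size) * (1 + f.size)
  | .quot e f => e.weight + f.weight + (1 + e.size) * (1 + f.size)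

/-- Each arithmetic operation produces at most the sum of the operand lengths plus one bit, so
lengths grow linearly in the fixed shape of the term. -/
theorem Arith.bitLen_eval_le {W : ℕ} {s : Memory} (hs : s.Bounded W) (e : Arith) :
    bitLen (e.eval s) ≤ e.size * (W + 1) := by
  induction e with
  | const c => simp only [eval, size]; nlinarith
  | read a i ih => simp only [eval, size]; have := hs a (i.eval s); nlinarith
  | plus e f he hf =>
    simp only [eval, size]; have := bitLen_add_le (e.eval s) (f.eval s); nlinarith
  | minus e f he hf =>
    simp only [eval, size]; have := bitLen_sub_le (e.eval s) (f.eval s); nlinarith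
  | times e f he hf =>
    simp only [eval, size]; have := bitLen_mul_le (e.eval s) (f.eval s); nlinarith
  | quot e f he hf =>
    simp only [eval, size]; have := bitLen_ediv_le (e.eval s) (f.eval s); nlinarith

/-- The square comes from multiplication and division, which are charged the product of two lengths
that are linear in `W + 1`; all other charges are linear. -/
theorem Arith.cost_le {W : ℕ} {s : Memory} (hs : s.Bounded W) (e : Arith) :
    e.cost s ≤ e.weight * (W + 1) ^ 2 := by
  have linear : ∀ e f : Arith, 1 + bitLen (e.eval s) + bitLen (f.eval s) ≤
      (1 + e.size + f.size) * (W + 1) ^ 2 := fun e f => by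
    have h1 := e.bitLen_eval_le hs
    have h2 := f.bitLen_eval_le hs
    calc _ ≤ (1 + e.size + f.size) * (W + 1) := by nlinarith
      _ ≤ _ := Nat.mul_le_mul_left _ (Nat.le_self_pow two_ne_zero _)
  have quadratic : ∀ e f : Arith, (1 + bitLen (e.eval s)) * (1 + bitLen (f.eval s)) ≤
      (1 + e.size) * (1 + f.size) * (W + 1) ^ 2 := fun e f => by
    have h1 := e.bitLen_eval_le hs
    have h2 := f.bitLen_eval_le hs
    calc _ ≤ ((1 + e.size) * (W + 1)) * ((1 + f.size) * (W + 1)) :=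
          Nat.mul_le_mul (by nlinarith) (by nlinarith)
      _ = _ := by ring
  induction e with
  | const c => simp only [cost, weight]; exact Nat.le_mul_of_pos_right _ (by positivity)
  | read a i ih =>
    simp only [cost, weight, add_mul (Arith.weight _)]
    refine Nat.add_le_add ih ?_
    have h1 := i.bitLen_eval_le hs
    have h2 := hs a (i.eval s)
    calc _ ≤ (2 + i.size) * (W + 1) := by nlinarith
      _ ≤ _ := Nat.mul_le_mul_left _ (Nat.le_self_pow two_ne_zero _)
  | plus e f he hf => simp only [cost, weight]; have := linear e f; linarith
  | minus e f he hf => simp only [cost, weight]; have := linear e f; linarith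
  | times e f he hf => simp only [cost, weight]; have := quadratic e f; linarith
  | quot e f he hf => simp only [cost, weight]; have := quadratic e f; linarith

/-! ### Program logic with time bounds -/

/-- The constant in the cost estimate for a program. -/
def Prog.weight : Prog → ℕ
  | .skip => 1
  | .write _ i e => i.weight + e.weight + (1 + i.size + e.size)
  | .seq p p' => p.weight + p'.weight
  | .ifPos e p p' => e.weight + 1 + p.weight + p'.weight
  | .whilePos e p => 2 * (e.weight + 1) + p.weight

/-- Started in memory `s`, the program `p` halts in a memory with words of at most `W` bits which
satisfies `Q`, at a cost that `W` and the nesting depth `d` of its loops control. -/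
def Prog.Ensures (W d : ℕ) (p : Prog) (s : Memory) (Q : Memory → Prop) : Prop :=
  ∃ s' t, p.Runs s s' t ∧ t ≤ p.weight * (W + 1) ^ (d + 2) ∧ s'.Bounded W ∧ Q s'

theorem Prog.Ensures.mono {W d d' : ℕ} {p : Prog} {s : Memory} {Q Q' : Memory → Prop}
    (h : p.Ensures W d s Q) (hd : d ≤ d') (hQ : ∀ s', Q s' → Q' s') : p.Ensures W d' s Q' := by
  obtain ⟨s', t, hr, ht, hb, hq⟩ := h
  exact ⟨s', t, hr, ht.trans (Nat.mul_le_mul_left _ (Nat.pow_le_pow_right (by omega) (by omega))),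
    hb, hQ _ hq⟩

/-- Only the stored value has to fit into `W` bits. Intermediate values of terms may be longer,
which `Arith.weight` already accounts for. -/
theorem Prog.Ensures.write {W d : ℕ} {s : Memory} {Q : Memory → Prop} (hs : s.Bounded W) (a : ℕ)
    (i e : Arith) (he : bitLen (e.eval s) ≤ W) (hQ : Q (s.store a (i.eval s) (e.eval s))) :
    (Prog.write a i e).Ensures W d s Q := by
  refine ⟨_, _, .write a i e s, ?_, hs.store _ _ he, hQ⟩
  refine le_trans ?_ (Nat.mul_le_mul_left _
    (Nat.pow_le_pow_right (by omega) (by omega : 2 ≤ d + 2)))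
  have h1 := i.cost_le hs
  have h2 := e.cost_le hs
  have h3 := i.bitLen_eval_le hs
  have h4 := e.bitLen_eval_le hs
  have h5 : 1 + bitLen (i.eval s) + bitLen (e.eval s) ≤ (1 + i.size + e.size) * (W + 1) ^ 2 :=
    calc _ ≤ (1 + i.size + e.size) * (W + 1) := by nlinarith
      _ ≤ _ := Nat.mul_le_mul_left _ (Nat.le_self_pow two_ne_zero _)
  simp only [Prog.weight]
  linarith

theorem Prog.Ensures.seq {W d : ℕ} {p p' : Prog} {s : Memory} {Q R : Memory → Prop}
    (h : p.Ensures W d s R) (h' : ∀ s', s'.Bounded W → R s' → p'.Ensures W d s' Q) :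
    (Prog.seq p p').Ensures W d s Q := by
  obtain ⟨s', t, hr, ht, hb, hq⟩ := h
  obtain ⟨s'', t', hr', ht', hb', hq'⟩ := h' s' hb hq
  refine ⟨s'', t + t', .seq hr hr', ?_, hb', hq'⟩
  simp only [Prog.weight]
  linarith

theorem Prog.Ensures.ifPos {W d : ℕ} {e : Arith} {p p' : Prog} {s : Memory} {Q : Memory → Prop}
    (hs : s.Bounded W) (h : 0 < e.eval s → p.Ensures W d s Q)
    (h' : ¬ 0 < e.eval s → p'.Ensures W d s Q) : (Prog.ifPos e p p').Ensures W d s Q := by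
  have h1 : e.cost s + 1 ≤ (e.weight + 1) * (W + 1) ^ (d + 2) := by
    have := e.cost_le hs
    calc _ ≤ (e.weight + 1) * (W + 1) ^ 2 := by nlinarith [Nat.one_le_pow 2 (W + 1) (by omega)]
      _ ≤ _ := Nat.mul_le_mul_left _ (Nat.pow_le_pow_right (by omega) (by omega))
  have h2 : 0 ≤ p.weight * (W + 1) ^ (d + 2) := Nat.zero_le _
  have h3 : 0 ≤ p'.weight * (W + 1) ^ (d + 2) := Nat.zero_le _
  by_cases h0 : 0 < e.eval s
  · obtain ⟨s', t, hr, ht, hb, hq⟩ := h h0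
    refine ⟨s', _, .ifPos_true h0 hr, ?_, hb, hq⟩
    simp only [Prog.weight]
    linarith
  · obtain ⟨s', t, hr, ht, hb, hq⟩ := h' h0
    refine ⟨s', _, .ifPos_false h0 hr, ?_, hb, hq⟩
    simp only [Prog.weight]
    linarith

/-- At most `W` rounds and `W + 1` tests occur, so a loop costs one more factor `W + 1`; this is why
the exponent counts nesting depth. -/
theorem Prog.Ensures.whilePos {W d n : ℕ} {e : Arith} {p : Prog} (I : ℕ → Memory → Prop)
    (hn : n ≤ W) (he : ∀ k s, k ≤ n → I k s → (0 < e.eval s ↔ k < n))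
    (hp : ∀ k s, k < n → s.Bounded W → I k s → p.Ensures W d s (I (k + 1)))
    {s : Memory} (hs : s.Bounded W) (h0 : I 0 s) :
    (Prog.whilePos e p).Ensures W (d + 1) s (I n) := by
  set c := (e.weight + 1) * (W + 1) ^ (d + 2) with hc
  have test : ∀ s : Memory, s.Bounded W → e.cost s + 1 ≤ c := fun s hs => by
    have := e.cost_le hs
    calc _ ≤ (e.weight + 1) * (W + 1) ^ 2 := by nlinarith [Nat.one_le_pow 2 (W + 1) (by omega)]
      _ ≤ _ := Nat.mul_le_mul_left _ (Nat.pow_le_pow_right (by omega) (by omega))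
  have main : ∀ m k s, m + k = n → s.Bounded W → I k s → ∃ s' t, (Prog.whilePos e p).Runs s s' t ∧
      t ≤ m * (c + p.weight * (W + 1) ^ (d + 2)) + c ∧ s'.Bounded W ∧ I n s' := by
    intro m
    induction m with
    | zero =>
      intro k s hk hs hI
      obtain rfl : k = n := by omega
      exact ⟨s, _, .whilePos_done (by rw [he k s le_rfl hI]; omega), by have := test s hs; omega,
        hs, hI⟩
    | succ m ih =>
      intro k s hk hs hI
      obtain ⟨s₁, t₁, hr₁, ht₁, hb₁, hI₁⟩ := hp k s (by omega) hs hI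
      obtain ⟨s₂, t₂, hr₂, ht₂, hb₂, hI₂⟩ := ih (k + 1) s₁ (by omega) hb₁ hI₁
      refine ⟨s₂, _, .whilePos_step ((he k s (by omega) hI).mpr (by omega)) hr₁ hr₂, ?_, hb₂, hI₂⟩
      have := test s hs
      rw [add_mul m, one_mul]
      omega
  obtain ⟨s', t, hr, ht, hb, hI⟩ := main n 0 s (by omega) hs h0
  refine ⟨s', t, hr, ht.trans ?_, hb, hI⟩
  have h1 : n * (c + p.weight * (W + 1) ^ (d + 2)) ≤ W * (c + p.weight * (W + 1) ^ (d + 2)) :=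
    Nat.mul_le_mul_right _ hn
  have h2 : (Prog.whilePos e p).weight * (W + 1) ^ (d + 1 + 2) =
      (W + 1) * (2 * c + p.weight * (W + 1) ^ (d + 2)) := by
    simp only [Prog.weight, hc]
    ring
  rw [h2]
  nlinarith [Nat.zero_le (W * c), Nat.zero_le (p.weight * (W + 1) ^ (d + 2))]

/-! ### Variables and counting loops -/

/-- The scalar variable `v`, kept in cell `0` of array `v`. -/
abbrev Arith.var (v : ℕ) : Arith := .read v (.const 0)

/-- Assignment to the scalar variable `v`. -/
abbrev Prog.assign (v : ℕ) (e : Arith) : Prog := .write v (.const 0) e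

/-- `for v = 0, …, N - 1 do p`. -/
def Prog.forLoop (v : ℕ) (N : Arith) (p : Prog) : Prog :=
  .seq (.assign v (.const 0))
    (.whilePos (.minus N (.var v)) (.seq p (.assign v (.plus (.var v) (.const 1)))))

/-- The loop itself overwrites the counter, so the invariant must be insensitive to it, and the body
must leave it unchanged. -/
theorem Prog.Ensures.forLoop {W d n v : ℕ} {N : Arith} {p : Prog} (I : ℕ → Memory → Prop)
    (hn : n ≤ W) (hI : ∀ k s x, I k s → I k (s.store v 0 x))
    (hN : ∀ k s, I k s → N.eval s = n)
    (hp : ∀ (k : ℕ) (s : Memory), k < n → s.Bounded W → s v 0 = (k : ℤ) → I k s →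
      p.Ensures W d s fun s' => s' v 0 = (k : ℤ) ∧ I (k + 1) s')
    {s : Memory} (hs : s.Bounded W) (h0 : I 0 s) :
    (Prog.forLoop v N p).Ensures W (d + 1) s (I n) := by
  refine .seq (R := fun s' => s' v 0 = ((0 : ℕ) : ℤ) ∧ I 0 s')
    (.write hs _ _ _ (by simp [Arith.eval, bitLen_zero]) ⟨by simp [Arith.eval], hI _ _ _ h0⟩) ?_
  intro s' hs' h0'
  refine Prog.Ensures.mono (Prog.Ensures.whilePos (fun k s => s v 0 = (k : ℤ) ∧ I k s) hn ?_ ?_ hs' h0')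
    le_rfl fun _ h => h.2
  · rintro k s - ⟨hk, h⟩
    simp only [Arith.eval, hN k s h, hk]
    omega
  · rintro k s hk hs ⟨hv, h⟩
    refine .seq (hp k s hk hs hv h) fun s' hs' h' => .write hs' _ _ _ ?_ ⟨?_, hI _ _ _ h'.2⟩
    · simp only [Arith.eval, h'.1]
      exact (bitLen_natCast_le (k + 1)).trans (by omega)
    · simp [Arith.eval, h'.1]

/-! ### Jacobi's formula and the coefficients of the adjugate of `X - A` -/

-- By Cramer's rule the `i`-th diagonal entry on the right is the determinant with column `i`
-- differentiated. Summing over `i` gives the product rule for each term of the Leibniz expansion.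
open Polynomial in
theorem Matrix.derivative_det {n : Type*} [Fintype n] [DecidableEq n] {R : Type*} [CommRing R]
    (M : Matrix n n R[X]) :
    derivative M.det = (M.adjugate * M.map derivative).trace := by
  have key : ∀ i, (M.adjugate * M.map derivative) i i =
      (M.updateCol i fun j => derivative (M j i)).det := fun i => by
    rw [← Matrix.cramer_apply, Matrix.cramer_eq_adjugate_mulVec]
    rfl
  simp only [Matrix.trace, Matrix.diag, key, Matrix.det_apply, derivative_sum]
  rw [Finset.sum_comm]
  refine Finset.sum_congr rfl fun σ _ => ?_
  rw [← Finset.smul_sum]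
  have : ∀ p : R[X], derivative (Equiv.Perm.sign σ • p) = Equiv.Perm.sign σ • derivative p :=
    fun p => by rw [Units.smul_def, Units.smul_def, derivative_smul]
  rw [this, derivative_prod_finset]
  congr 1
  refine Finset.sum_congr rfl fun i _ => ?_
  rw [← Finset.mul_prod_erase _ _ (Finset.mem_univ i), mul_comm]
  congr 1
  · simp
  · refine Finset.prod_congr rfl fun j hj => ?_
    rw [Matrix.updateCol_ne (Finset.ne_of_mem_erase hj)]

open Polynomial in
/-- The coefficient of degree `k` of the adjugate of the characteristic matrix. -/
noncomputable def Matrix.adjCoeff {n : Type*} [Fintype n] [DecidableEq n] {R : Type*} [CommRing R]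
    (A : Matrix n n R) (k : ℕ) : Matrix n n R :=
  A.charmatrix.adjugate.map fun p => p.coeff k

section
variable {n : Type*} [Fintype n] [DecidableEq n] {R : Type*} [CommRing R] (A : Matrix n n R)

open Polynomial

/-- Since `X - A` has derivative `1`, Jacobi's formula says that the trace of its adjugate is the
derivative of the characteristic polynomial. -/
theorem Matrix.trace_adjCoeff (k : ℕ) :
    (A.adjCoeff k).trace = (k + 1) * A.charpoly.coeff (k + 1) := by
  have h : A.charmatrix.map derivative = 1 := by
    ext i j : 1
    by_cases hij : i = j
    · subst hij; simp [Matrix.charmatrix_apply_eq]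
    · simp [hij, Matrix.charmatrix_apply_ne]
  have := congrArg (fun p => p.coeff k) (Matrix.derivative_det A.charmatrix)
  simp only [h, mul_one, coeff_derivative, Matrix.trace, Matrix.diag] at this
  rw [finsetSum_coeff] at this
  rw [mul_comm]
  exact this.symm

/-- Compare coefficients of `X ^ (k + 1)` in `adj(X - A) * (X - A) = charpoly • 1`. -/
theorem Matrix.adjCoeff_mul_add (k : ℕ) :
    A.adjCoeff k = A.adjCoeff (k + 1) * A + A.charpoly.coeff (k + 1) • 1 := by
  ext i j
  have h : (A.charmatrix.adjugate * A.charmatrix) i j = (A.charpoly • (1 : Matrix n n R[X])) i j := by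
    rw [Matrix.adjugate_mul]; rfl
  have h1 : (A.charmatrix.adjugate * A.charmatrix) i j =
      A.charmatrix.adjugate i j * X - ∑ l, A.charmatrix.adjugate i l * C (A l j) := by
    rw [Matrix.charmatrix, mul_sub, Matrix.sub_apply]
    congr 1
    · simp [Matrix.mul_apply, Matrix.scalar_apply, Matrix.diagonal_apply]
  rw [h1] at h
  have := congrArg (fun p => p.coeff (k + 1)) h
  simp only [coeff_sub, coeff_mul_X, finsetSum_coeff, coeff_mul_C, Matrix.smul_apply,
    Matrix.one_apply] at this
  rw [sub_eq_iff_eq_add'] at this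
  simp only [Matrix.adjCoeff, Matrix.add_apply, Matrix.mul_apply, Matrix.map_apply,
    Matrix.smul_apply, Matrix.one_apply]
  rw [this]
  split_ifs <;> simp

/-- The coefficients vanish for large `k`. Descending with `adjCoeff_mul_add` preserves this as long
as the coefficient of the characteristic polynomial involved lies above its degree. -/
theorem Matrix.adjCoeff_eq_zero (k : ℕ) (hk : Fintype.card n ≤ k) : A.adjCoeff k = 0 := by
  nontriviality R
  obtain ⟨m, hm⟩ : ∃ m, ∀ k, m ≤ k → A.adjCoeff k = 0 := by
    refine ⟨(Finset.univ.sup fun i => Finset.univ.sup fun j =>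
      (A.charmatrix.adjugate i j).natDegree) + 1, fun k hk => ?_⟩
    ext i j
    refine coeff_eq_zero_of_natDegree_lt (lt_of_le_of_lt ?_ (Nat.lt_of_succ_le hk))
    exact (Finset.le_sup (f := fun j => (A.charmatrix.adjugate i j).natDegree)
      (Finset.mem_univ j)).trans (Finset.le_sup (f := fun i => Finset.univ.sup fun j =>
      (A.charmatrix.adjugate i j).natDegree) (Finset.mem_univ i))
  by_cases h : m ≤ k
  · exact hm k h
  refine Nat.decreasingInduction' (P := fun k => A.adjCoeff k = 0) ?_ (not_le.mp h).le (hm m le_rfl)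
  intro l _ hl h0
  rw [Matrix.adjCoeff_mul_add, h0, coeff_eq_zero_of_natDegree_lt]
  · simp
  · rw [Matrix.charpoly_natDegree_eq_dim]; omega

/-- Taking traces in `adjCoeff_mul_add` and inserting `trace_adjCoeff` recovers a coefficient of the
characteristic polynomial from a trace. That recursion does not see the constant term, so `k = 0` is
read off from `adj(X - A) * (X - A)` directly. -/
theorem Matrix.trace_adjCoeff_mul (k : ℕ) :
    (A.adjCoeff k * A).trace = (k - Fintype.card n) * A.charpoly.coeff k := by
  cases k with
  | zero =>
    have h : (A.charmatrix.adjugate * A.charmatrix).map (fun p => p.coeff 0) =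
        A.charpoly.coeff 0 • (1 : Matrix n n R) := by
      rw [Matrix.adjugate_mul]
      ext i j
      simp [Matrix.one_apply, Matrix.charpoly]
      split_ifs <;> simp
    have h1 : (A.charmatrix.adjugate * A.charmatrix).map (fun p => p.coeff 0) =
        -(A.adjCoeff 0 * A) := by
      ext i j
      simp [Matrix.mul_apply, Matrix.adjCoeff, Matrix.charmatrix, Matrix.diagonal_apply, mul_coeff_zero]
      rw [← Finset.sum_neg_distrib]
      refine Finset.sum_congr rfl fun l _ => ?_
      split_ifs <;> simp
    rw [h1, neg_eq_iff_eq_neg] at h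
    rw [h]
    simp [Matrix.trace_neg, Matrix.trace_smul]
    ring
  | succ k =>
    have h := congrArg Matrix.trace (A.adjCoeff_mul_add k)
    rw [Matrix.trace_add, Matrix.trace_adjCoeff, Matrix.trace_smul, Matrix.trace_one] at h
    rw [← sub_eq_iff_eq_add] at h
    rw [← h, smul_eq_mul]
    push_cast
    ring
end

/-! ### The Faddeev–LeVerrier recursion over the integers -/

/-- The Faddeev–LeVerrier recursion for the first `n` rows and columns of `A`. -/
def leverrier (n : ℕ) (A : ℕ → ℕ → ℤ) : ℕ → (ℕ → ℕ → ℤ) × ℤ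
  | 0 => (fun _ _ => 0, 1)
  | k + 1 =>
    let P := fun i j => A i j * (leverrier n A k).2 +
      ∑ l ∈ Finset.range n, (leverrier n A k).1 i l * A l j
    (P, (0 - ∑ i ∈ Finset.range n, P i i) / ((k : ℤ) + 1))

/-- The matrix step is `adjCoeff_mul_add` multiplied by `B` on the right. By `trace_adjCoeff_mul`
the trace is `-(k + 1)` times the next coefficient, so the integer division is exact. -/
theorem leverrier_eq {n : ℕ} {A : ℕ → ℕ → ℤ} {B : Matrix (Fin n) (Fin n) ℤ}
    (hB : ∀ i j : Fin n, A i j = B i j) {k : ℕ} (hk : k ≤ n) :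
    (∀ i j : Fin n, (leverrier n A k).1 i j = (B.adjCoeff (n - k) * B) i j) ∧
      (leverrier n A k).2 = B.charpoly.coeff (n - k) := by
  induction k with
  | zero =>
    constructor
    · intro i j
      simp [leverrier, Matrix.adjCoeff_eq_zero]
    · have := B.charpoly_monic.coeff_natDegree
      rw [Matrix.charpoly_natDegree_eq_dim, Fintype.card_fin] at this
      exact this.symm
  | succ k ih =>
    obtain ⟨ih1, ih2⟩ := ih (by omega)
    obtain ⟨m, rfl⟩ : ∃ m, n = m + (k + 1) := ⟨n - (k + 1), by omega⟩
    rw [show m + (k + 1) - k = m + 1 by omega] at ih1 ih2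
    rw [show m + (k + 1) - (k + 1) = m by omega]
    have h1 : ∀ i j : Fin (m + (k + 1)),
        (leverrier (m + (k + 1)) A (k + 1)).1 i j = (B.adjCoeff m * B) i j := by
      intro i j
      rw [Matrix.adjCoeff_mul_add, add_mul, Matrix.add_apply, Matrix.mul_apply, smul_mul_assoc,
        one_mul, Matrix.smul_apply, smul_eq_mul, ← ih2]
      simp only [leverrier, Finset.sum_range, ih1, hB]
      ring
    refine ⟨h1, ?_⟩
    have h2 : ∑ i ∈ Finset.range (m + (k + 1)), (leverrier (m + (k + 1)) A (k + 1)).1 i i =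
        -(((k : ℤ) + 1) * B.charpoly.coeff m) := by
      rw [Finset.sum_range]
      simp only [h1]
      have := B.trace_adjCoeff_mul m
      rw [Matrix.trace] at this
      simp only [Matrix.diag] at this
      rw [this, Fintype.card_fin]
      push_cast
      ring
    change (0 - ∑ i ∈ Finset.range (m + (k + 1)), (leverrier (m + (k + 1)) A (k + 1)).1 i i) /
      ((k : ℤ) + 1) = _
    rw [h2, zero_sub, neg_neg]
    exact Int.mul_ediv_cancel_left _ (by positivity)

theorem abs_leverrier {n : ℕ} {A : ℕ → ℕ → ℤ} {B : Matrix (Fin n) (Fin n) ℤ}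
    (hB : ∀ i j : Fin n, A i j = B i j) : |(leverrier n A n).2| = B.det.natAbs := by
  rw [(leverrier_eq hB le_rfl).2, Nat.sub_self, ← Int.abs_eq_natAbs, B.det_eq_sign_charpoly_coeff,
    abs_mul, abs_pow]
  simp

/-! ### Growth of the numbers in the recursion -/

section
variable {n : ℕ} {A : ℕ → ℕ → ℤ} {a : ℤ}

/-- Partial sums (`m ≤ n`) are covered because the program stores each of them in its accumulator.
-/
theorem abs_leverrier_partial_le (hA : ∀ i j, |A i j| ≤ a) {k : ℕ} {X : ℤ}
    (h1 : ∀ i j, |(leverrier n A k).1 i j| ≤ X) (h2 : |(leverrier n A k).2| ≤ X)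
    {m : ℕ} (hm : m ≤ n) (i j : ℕ) :
    |A i j * (leverrier n A k).2 + ∑ l ∈ Finset.range m, (leverrier n A k).1 i l * A l j| ≤
      (n + 1) * (a * X) := by
  have ha : 0 ≤ a := (abs_nonneg _).trans (hA 0 0)
  have hX : 0 ≤ X := (abs_nonneg _).trans h2
  have h3 : |∑ l ∈ Finset.range m, (leverrier n A k).1 i l * A l j| ≤ n * (a * X) := by
    refine (Finset.abs_sum_le_sum_abs _ _).trans ?_
    refine (Finset.sum_le_card_nsmul _ _ (a * X) fun l _ => ?_).trans ?_
    · rw [abs_mul, mul_comm a]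
      exact mul_le_mul (h1 _ _) (hA _ _) (abs_nonneg _) hX
    · rw [Finset.card_range, nsmul_eq_mul]
      exact mul_le_mul_of_nonneg_right (by exact_mod_cast hm) (by positivity)
  have h4 : |A i j * (leverrier n A k).2| ≤ a * X := by
    rw [abs_mul]
    exact mul_le_mul (hA _ _) h2 (abs_nonneg _) ha
  have := abs_add_le (A i j * (leverrier n A k).2)
    (∑ l ∈ Finset.range m, (leverrier n A k).1 i l * A l j)
  linarith

theorem abs_trace_leverrier_partial_le {k : ℕ} {Y : ℤ}
    (h : ∀ i j, |(leverrier n A k).1 i j| ≤ Y) {m : ℕ} (hm : m ≤ n) :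
    |∑ i ∈ Finset.range m, (leverrier n A k).1 i i| ≤ n * Y := by
  have hY : 0 ≤ Y := (abs_nonneg _).trans (h 0 0)
  refine (Finset.abs_sum_le_sum_abs _ _).trans ?_
  refine (Finset.sum_le_card_nsmul _ _ Y fun l _ => h l l).trans ?_
  rw [Finset.card_range, nsmul_eq_mul]
  exact mul_le_mul_of_nonneg_right (by exact_mod_cast hm) hY

/-- One step multiplies the entries by at most `(n + 1) * a` and the trace by at most a further `n`,
so `(n + 1)^2 * a` serves for both. -/
theorem abs_leverrier_le (ha : 1 ≤ a) (hA : ∀ i j, |A i j| ≤ a) (k : ℕ) :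
    (∀ i j, |(leverrier n A k).1 i j| ≤ (((n : ℤ) + 1) ^ 2 * a) ^ k) ∧
      |(leverrier n A k).2| ≤ (((n : ℤ) + 1) ^ 2 * a) ^ k := by
  induction k with
  | zero => simp [leverrier]
  | succ k ih =>
    set X := (((n : ℤ) + 1) ^ 2 * a) ^ k
    have hX : 0 ≤ X := (abs_nonneg _).trans ih.2
    have h1 : ∀ i j, |(leverrier n A (k + 1)).1 i j| ≤ (n + 1) * (a * X) :=
      abs_leverrier_partial_le hA ih.1 ih.2 le_rfl
    have hn : (0 : ℤ) ≤ n := by positivity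
    have h0 : 0 ≤ (n + 1) * (a * X) := by positivity
    have h3 : (((n : ℤ) + 1) ^ 2 * a) ^ (k + 1) = (n + 1) * ((n + 1) * (a * X)) := by
      simp only [X]; ring
    rw [h3]
    refine ⟨fun i j => (h1 i j).trans (by nlinarith), ?_⟩
    refine (Int.abs_ediv_le_abs _ _).trans ?_
    rw [zero_sub, abs_neg]
    refine (abs_trace_leverrier_partial_le h1 le_rfl).trans (by nlinarith)

end

/-! ### A program for the determinant -/

/-- The dimension, the first number in the input. -/
abbrev dimTerm : Arith := .read 0 (.const 1)

/-- The entry `(i, j)` of the input matrix. -/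
abbrev entryTerm (i j : Arith) : Arith :=
  .read 0 (.plus (.const 2) (.plus (.times i dimTerm) j))

/-- The cell of entry `(i, j)` of the `k`-th matrix of the Faddeev–LeVerrier recursion. -/
abbrev cellTerm (k i j : Arith) : Arith :=
  .plus (.times (.plus (.times k dimTerm) i) dimTerm) j

namespace DetProg

/-- Adds the terms of a matrix product to the variable `7`. -/
def product : Prog :=
  .forLoop 6 dimTerm (.assign 7 (.plus (.var 7)
    (.times (.read 10 (cellTerm (.var 3) (.var 4) (.var 6))) (entryTerm (.var 6) (.var 5)))))

/-- Computes row `i` of the next matrix. -/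
def row : Prog :=
  .forLoop 5 dimTerm (.seq
    (.assign 7 (.times (entryTerm (.var 4) (.var 5)) (.read 11 (.var 3))))
    (.seq product
      (.write 10 (cellTerm (.plus (.var 3) (.const 1)) (.var 4) (.var 5)) (.var 7))))

/-- Computes the next matrix, and its trace in the variable `8`. -/
def next : Prog :=
  .forLoop 4 dimTerm (.seq row (.assign 8 (.plus (.var 8)
    (.read 10 (cellTerm (.plus (.var 3) (.const 1)) (.var 4) (.var 4))))))

/-- Computes all matrices and coefficients of the recursion. -/
def iterate : Prog :=
  .forLoop 3 dimTerm (.seq (.assign 8 (.const 0)) (.seq next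
    (.write 11 (.plus (.var 3) (.const 1))
      (.quot (.minus (.const 0) (.var 8)) (.plus (.var 3) (.const 1))))))

/-- Computes the absolute value of the determinant in the variable `2`. -/
def absDet : Prog :=
  .seq (.write 11 (.const 0) (.const 1)) (.seq iterate
    (.ifPos (.read 11 dimTerm) (.assign 2 (.read 11 dimTerm))
      (.assign 2 (.minus (.const 0) (.read 11 dimTerm)))))

/-- The memory holds the coefficients up to the `k`-th one and the matrix entries before cell
`z`. -/
structure State (n : ℕ) (inp : ℤ → ℤ) (A : ℕ → ℕ → ℤ) (k z : ℕ) (s : Memory) : Prop where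
  input : s 0 = inp
  coeff : ∀ m : ℕ, m ≤ k → s 11 m = (leverrier n A m).2
  entry : ∀ m i j : ℕ, i < n → j < n → (m * n + i) * n + j < z →
    s 10 (((m : ℤ) * n + i) * n + j) = (leverrier n A m).1 i j

/-- The hypotheses on the input and the word length. -/
structure Setting (n W : ℕ) (inp : ℤ → ℤ) (A : ℕ → ℕ → ℤ) (a : ℤ) : Prop where
  dim : inp 1 = n
  entries : ∀ i j : ℕ, inp (2 + ((i : ℤ) * n + j)) = A i j
  one_le : 1 ≤ a
  abs_le : ∀ i j, |A i j| ≤ a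
  dim_le : n ≤ W
  word : ∀ x : ℤ, |x| ≤ (((n : ℤ) + 1) ^ 2 * a) ^ n → bitLen x ≤ W

variable {n W : ℕ} {inp : ℤ → ℤ} {A : ℕ → ℕ → ℤ} {a : ℤ} {k z : ℕ} {s : Memory}

theorem State.store (h : State n inp A k z s) {v : ℕ} (hv : v ≠ 0 ∧ v ≠ 10 ∧ v ≠ 11) (i x : ℤ) :
    State n inp A k z (s.store v i x) := by
  obtain ⟨h0, h1, h2⟩ := hv
  constructor
  · rw [Memory.store_of_ne h0.symm, h.input]
  · rw [Memory.store_of_ne h2.symm]; exact h.coeff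
  · rw [Memory.store_of_ne h1.symm]; exact h.entry

theorem Setting.word_of_le (h : Setting n W inp A a) {k : ℕ} (hk : k < n) {x : ℤ}
    (hx : |x| ≤ n * ((n + 1) * (a * (((n : ℤ) + 1) ^ 2 * a) ^ k))) : bitLen x ≤ W := by
  have ha := h.one_le
  have h1 : (1 : ℤ) ≤ ((n : ℤ) + 1) ^ 2 * a := by nlinarith [Int.natCast_nonneg n]
  refine h.word x (hx.trans (le_trans ?_ (pow_le_pow_right₀ h1 hk)))
  set X := (((n : ℤ) + 1) ^ 2 * a) ^ k with hX
  have : 0 ≤ ((n : ℤ) + 1) * (a * X) := by positivity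
  calc _ ≤ ((n : ℤ) + 1) * ((n + 1) * (a * X)) := by linarith
    _ = _ := by rw [Nat.succ_eq_add_one, pow_succ, ← hX]; ring

theorem Setting.word_product (h : Setting n W inp A a) (hk : k < n) {m : ℕ} (hm : m ≤ n)
    (i j : ℕ) : bitLen (A i j * (leverrier n A k).2 +
      ∑ l ∈ Finset.range m, (leverrier n A k).1 i l * A l j) ≤ W := by
  obtain ⟨h1, h2⟩ := abs_leverrier_le (n := n) h.one_le h.abs_le k
  refine h.word_of_le hk ((abs_leverrier_partial_le h.abs_le h1 h2 hm i j).trans ?_)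
  have ha := h.one_le
  have h3 : (1 : ℤ) ≤ n := by exact_mod_cast (by omega : 1 ≤ n)
  have : 0 ≤ ((n : ℤ) + 1) * (a * (((n : ℤ) + 1) ^ 2 * a) ^ k) := by positivity
  nlinarith

theorem Setting.word_trace (h : Setting n W inp A a) (hk : k < n) {m : ℕ} (hm : m ≤ n) :
    bitLen (∑ i ∈ Finset.range m, (leverrier n A (k + 1)).1 i i) ≤ W := by
  obtain ⟨h1, h2⟩ := abs_leverrier_le (n := n) h.one_le h.abs_le k
  exact h.word_of_le hk (abs_trace_leverrier_partial_le
    (fun i j => abs_leverrier_partial_le h.abs_le h1 h2 le_rfl i j) hm)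

/-- Matrix `m` occupies the cells from `m * n * n` up to `(m + 1) * n * n`, so `hz` says that the
`k`-th matrix is complete and may be read. -/
theorem ensures_product (h : Setting n W inp A a) (hk : k < n) (hz : (k + 1) * n * n ≤ z)
    {i j : ℕ} (hi : i < n) (T : ℤ) (hs : s.Bounded W)
    (hS : State n inp A k z s) (h3 : s 3 0 = k) (h4 : s 4 0 = i) (h5 : s 5 0 = j) (h8 : s 8 0 = T)
    (h7 : s 7 0 = A i j * (leverrier n A k).2) :
    product.Ensures W 1 s fun s' => State n inp A k z s' ∧ s' 3 0 = k ∧ s' 4 0 = i ∧ s' 5 0 = j ∧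
      s' 8 0 = T ∧ s' 7 0 = (leverrier n A (k + 1)).1 i j := by
  refine Prog.Ensures.forLoop (fun m s' => State n inp A k z s' ∧ s' 3 0 = k ∧ s' 4 0 = i ∧
    s' 5 0 = j ∧ s' 8 0 = T ∧ s' 7 0 = A i j * (leverrier n A k).2 +
      ∑ l ∈ Finset.range m, (leverrier n A k).1 i l * A l j) h.dim_le ?_ ?_ ?_ hs ?_
  · rintro m s x ⟨hS, h⟩
    exact ⟨hS.store (by decide) _ _, by simpa [Memory.store] using h⟩
  · rintro m s ⟨hS, -⟩
    simp [Arith.eval, hS.input, h.dim]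
  · rintro m s hm hs h6 ⟨hS, h3, h4, h5, h8, h7⟩
    have hz' : (k * n + i) * n + m < z := by nlinarith
    have hv : (Arith.plus (.var 7) (.times (.read 10 (cellTerm (.var 3) (.var 4) (.var 6)))
        (entryTerm (.var 6) (.var 5)))).eval s = A i j * (leverrier n A k).2 +
        ∑ l ∈ Finset.range (m + 1), (leverrier n A k).1 i l * A l j := by
      simp only [Arith.eval, h3, h4, h5, h6, h7, hS.input, h.dim, h.entries,
        hS.entry k i m hi hm hz', Finset.sum_range_succ, add_assoc]
    refine .write hs _ _ _ ?_ ?_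
    · rw [hv]; exact h.word_product hk hm i j
    · rw [hv]
      refine ⟨by simpa [Memory.store] using h6, hS.store (by decide) _ _, ?_⟩
      simp [Memory.store, h3, h4, h5, h8, Arith.eval]
  · exact ⟨hS, h3, h4, h5, h8, by simpa using h7⟩

/-- The address is a base-`n` expansion with digits `i`, `j` and leading part `m`. Reducing modulo
`n` twice shows that it determines the triple, so nothing stored earlier is overwritten. -/
theorem State.write_entry (hS : State n inp A k z s) {m i j : ℕ} (hi : i < n) (hj : j < n)
    (hz : z = (m * n + i) * n + j) {x : ℤ} (hx : x = (leverrier n A m).1 i j) :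
    State n inp A k (z + 1) (s.store 10 (((m : ℤ) * n + i) * n + j) x) := by
  constructor
  · rw [Memory.store_of_ne (by decide), hS.input]
  · rw [Memory.store_of_ne (by decide)]; exact hS.coeff
  · intro m' i' j' hi' hj' h
    by_cases h0 : (m' * n + i') * n + j' = z
    · have h1 : j' = j := by
        have := congrArg (· % n) (h0.trans hz)
        simpa [Nat.mul_add_mod_self_right, Nat.mod_eq_of_lt, hj, hj'] using this
      subst h1
      have h2 : m' * n + i' = m * n + i :=
        Nat.eq_of_mul_eq_mul_right (by omega : 0 < n) (by omega)
      have h3 : i' = i := by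
        have := congrArg (· % n) h2
        simpa [Nat.mul_add_mod_self_right, Nat.mod_eq_of_lt, hi, hi'] using this
      subst h3
      have h4 : m' = m := Nat.eq_of_mul_eq_mul_right (by omega : 0 < n) (by omega)
      subst h4
      rw [Memory.store_self, hx]
    · rw [Memory.store_cell_of_ne, hS.entry m' i' j' hi' hj' (by omega)]
      rw [hz] at h0
      exact_mod_cast h0

theorem ensures_row (h : Setting n W inp A a) (hk : k < n) {i : ℕ} (hi : i < n) (T : ℤ)
    (hs : s.Bounded W) (hS : State n inp A k (((k + 1) * n + i) * n) s) (h3 : s 3 0 = k)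
    (h4 : s 4 0 = i) (h8 : s 8 0 = T) :
    row.Ensures W 2 s fun s' => State n inp A k (((k + 1) * n + (i + 1)) * n) s' ∧ s' 3 0 = k ∧
      s' 4 0 = i ∧ s' 8 0 = T := by
  refine (Prog.Ensures.forLoop (d := 1) (fun j s' => State n inp A k (((k + 1) * n + i) * n + j) s' ∧
    s' 3 0 = k ∧ s' 4 0 = i ∧ s' 8 0 = T) h.dim_le ?_ ?_ ?_ hs ⟨hS, h3, h4, h8⟩).mono le_rfl ?_
  · rintro j s x ⟨hS, h⟩
    exact ⟨hS.store (by decide) _ _, by simpa [Memory.store] using h⟩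
  · rintro m s ⟨hS, -⟩
    simp [Arith.eval, hS.input, h.dim]
  · rintro j s hj hs h5 ⟨hS, h3, h4, h8⟩
    have hv : (Arith.times (entryTerm (.var 4) (.var 5)) (.read 11 (.var 3))).eval s =
        A i j * (leverrier n A k).2 := by
      simp only [Arith.eval, h3, h4, h5, hS.input, h.dim, h.entries, hS.coeff k le_rfl]
    refine .seq (R := fun s' => State n inp A k (((k + 1) * n + i) * n + j) s' ∧
      s' 3 0 = k ∧ s' 4 0 = i ∧ s' 5 0 = j ∧ s' 8 0 = T ∧ s' 7 0 = A i j * (leverrier n A k).2)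
      (.write hs _ _ _ ?_ ?_) ?_
    · rw [hv]
      simpa using h.word_product hk (Nat.zero_le n) i j
    · rw [hv]
      refine ⟨hS.store (by decide) _ _, ?_⟩
      simp [Memory.store, h3, h4, h5, h8, Arith.eval]
    rintro s hs ⟨hS, h3, h4, h5, h8, h7⟩
    refine .seq (ensures_product h hk (by nlinarith) hi T hs hS h3 h4 h5 h8 h7) ?_
    rintro s hs ⟨hS, h3, h4, h5, h8, h7⟩
    refine .write hs _ _ _ (by simpa [Arith.eval] using hs 7 0) ?_
    have hS' := hS.write_entry (m := k + 1) hi hj rfl h7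
    simp only [Arith.eval, h3, h4, h5, hS.input, h.dim]
    push_cast at hS' ⊢
    refine ⟨by simp [Memory.store, h5], hS', ?_⟩
    simp [Memory.store, h3, h4, h8]
  · rintro s ⟨hS, h⟩
    refine ⟨?_, h⟩
    convert hS using 1
    ring

theorem ensures_next (h : Setting n W inp A a) (hk : k < n) (hs : s.Bounded W)
    (hS : State n inp A k ((k + 1) * n * n) s) (h3 : s 3 0 = k) (h8 : s 8 0 = 0) :
    next.Ensures W 3 s fun s' => State n inp A k ((k + 2) * n * n) s' ∧ s' 3 0 = k ∧
      s' 8 0 = ∑ i ∈ Finset.range n, (leverrier n A (k + 1)).1 i i := by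
  refine (Prog.Ensures.forLoop (d := 2) (fun i s' => State n inp A k (((k + 1) * n + i) * n) s' ∧
    s' 3 0 = k ∧ s' 8 0 = ∑ i ∈ Finset.range i, (leverrier n A (k + 1)).1 i i)
    h.dim_le ?_ ?_ ?_ hs ⟨hS, h3, by simpa using h8⟩).mono le_rfl ?_
  · rintro j s x ⟨hS, h⟩
    exact ⟨hS.store (by decide) _ _, by simpa [Memory.store] using h⟩
  · rintro m s ⟨hS, -⟩
    simp [Arith.eval, hS.input, h.dim]
  · rintro i s hi hs h4 ⟨hS, h3, h8⟩
    refine .seq (ensures_row h hk hi _ hs hS h3 h4 h8) ?_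
    rintro s hs ⟨hS, h3, h4, h8⟩
    have he := hS.entry (k + 1) i i hi hi (by nlinarith)
    push_cast at he
    have hv : (Arith.plus (.var 8) (.read 10
        (cellTerm (.plus (.var 3) (.const 1)) (.var 4) (.var 4)))).eval s =
        ∑ i ∈ Finset.range (i + 1), (leverrier n A (k + 1)).1 i i := by
      simp only [Arith.eval, h3, h4, h8, hS.input, h.dim, he, Finset.sum_range_succ]
    refine .write hs _ _ _ ?_ ?_
    · rw [hv]; exact h.word_trace hk hi
    · rw [hv]
      refine ⟨by simpa [Memory.store] using h4, hS.store (by decide) _ _, ?_⟩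
      simp [Memory.store, h3, Arith.eval]
  · rintro s ⟨hS, h⟩
    refine ⟨?_, h⟩
    convert hS using 1
    ring

theorem State.write_coeff (hS : State n inp A k z s) {x : ℤ} (hx : x = (leverrier n A (k + 1)).2) :
    State n inp A (k + 1) z (s.store 11 ((k : ℤ) + 1) x) := by
  constructor
  · rw [Memory.store_of_ne (by decide), hS.input]
  · intro m hm
    rcases Nat.lt_succ_iff_lt_or_eq.mp (Nat.lt_succ_of_le hm) with h | rfl
    · rw [Memory.store_cell_of_ne (by omega), hS.coeff m (by omega)]
    · push_cast
      rw [Memory.store_self, hx]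
  · rw [Memory.store_of_ne (by decide)]; exact hS.entry

theorem ensures_iterate (h : Setting n W inp A a) (hs : s.Bounded W)
    (hS : State n inp A 0 (n * n) s) :
    iterate.Ensures W 4 s fun s' => s' 0 = inp ∧ s' 11 n = (leverrier n A n).2 := by
  refine (Prog.Ensures.forLoop (d := 3) (fun k s' => State n inp A k ((k + 1) * n * n) s')
    h.dim_le ?_ ?_ ?_ hs (by simpa using hS)).mono le_rfl
    fun s hS => ⟨hS.input, hS.coeff n le_rfl⟩
  · rintro j s x hS
    exact hS.store (by decide) _ _
  · rintro m s hS
    simp [Arith.eval, hS.input, h.dim]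
  · rintro k s hk hs h3 hS
    refine .seq (R := fun s' => State n inp A k ((k + 1) * n * n) s' ∧ s' 3 0 = k ∧ s' 8 0 = 0)
      (.write hs _ _ _ (by simp [Arith.eval, bitLen_zero])
        ⟨hS.store (by decide) _ _, by simp [Memory.store, Arith.eval, h3]⟩) ?_
    rintro s hs ⟨hS, h3, h8⟩
    refine .seq (ensures_next h hk hs hS h3 h8) ?_
    rintro s hs ⟨hS, h3, h8⟩
    refine .write hs _ _ _ ?_ ?_
    · simp only [Arith.eval, h8]
      refine (bitLen_ediv_le _ _).trans ?_
      rw [zero_sub, bitLen_neg]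
      exact h.word_trace hk le_rfl
    · simp only [Arith.eval, h3, h8]
      exact ⟨by simp [Memory.store, h3], hS.write_coeff rfl⟩

theorem ensures_absDet (h : Setting n W inp A a) (hs : s.Bounded W) (h0 : s 0 = inp)
    (h10 : s 10 = 0) :
    absDet.Ensures W 4 s fun s' => s' 0 = inp ∧ s' 2 0 = |(leverrier n A n).2| := by
  refine .seq (R := State n inp A 0 (n * n)) (.write hs _ _ _ ?_ ?_) fun s hs hS =>
    .seq (ensures_iterate h hs hS) ?_
  · refine h.word _ ?_
    have ha := h.one_le
    simpa [Arith.eval] using one_le_pow₀ (M₀ := ℤ) (n := n)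
      (by nlinarith [Int.natCast_nonneg n] : 1 ≤ ((n : ℤ) + 1) ^ 2 * a)
  · constructor
    · simp [Memory.store_of_ne, h0]
    · intro m hm
      obtain rfl : m = 0 := by omega
      simp [Arith.eval, leverrier]
    · intro m i j hi hj hz
      -- Addresses below `n * n` belong to the zeroth matrix, which is zero and hence already
      -- present in the untouched array `10`.
      obtain rfl : m = 0 := by
        by_contra hm
        have : 1 ≤ m := by omega
        nlinarith
      simp [Memory.store_of_ne, h10, leverrier]
  · rintro s hs ⟨h0, h11⟩
    have hv : (Arith.read 11 dimTerm).eval s = (leverrier n A n).2 := by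
      simp only [Arith.eval, h0, h.dim, h11]
    have hb : bitLen (leverrier n A n).2 ≤ W := h11 ▸ hs 11 n
    refine .ifPos hs (fun hpos => ?_) fun hneg => ?_
    · rw [hv] at hpos
      refine .write hs _ _ _ (by rwa [hv]) ⟨by rw [Memory.store_of_ne (by decide), h0], ?_⟩
      rw [hv, abs_of_pos hpos]
      exact Memory.store_self ..
    · rw [hv] at hneg
      have hv' : (Arith.minus (.const 0) (.read 11 dimTerm)).eval s = -(leverrier n A n).2 := by
        rw [← hv]
        simp [Arith.eval]
      refine .write hs _ _ _ (by rwa [hv', bitLen_neg])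
        ⟨by rw [Memory.store_of_ne (by decide), h0], ?_⟩
      rw [hv', abs_of_nonpos (not_lt.mp hneg)]
      exact Memory.store_self ..

end DetProg

/-! ### Input and output lists -/

theorem divNat_mk_mul_add {k n : ℕ} (i : Fin k) (j : Fin n) (h : (i : ℕ) * n + j < k * n) :
    Fin.divNat ⟨i * n + j, h⟩ = i := by
  ext
  simp only [Fin.coe_divNat]
  rw [mul_comm, Nat.mul_add_div j.pos, Nat.div_eq_of_lt j.isLt, add_zero]

theorem modNat_mk_mul_add {k n : ℕ} (i : Fin k) (j : Fin n) (h : (i : ℕ) * n + j < k * n) :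
    Fin.modNat ⟨i * n + j, h⟩ = j := by
  ext
  simp only [Fin.coe_modNat]
  rw [Nat.mul_add_mod_self_right, Nat.mod_eq_of_lt j.isLt]

theorem matrixEntries_eq_ofFn {k n : ℕ} (M : Matrix (Fin k) (Fin n) ℤ) :
    matrixEntries M = List.ofFn fun t : Fin (k * n) => M t.divNat t.modNat := by
  simp only [List.ofFn_mul, matrixEntries, divNat_mk_mul_add, modNat_mk_mul_add]

theorem length_matrixEntries {k n : ℕ} (M : Matrix (Fin k) (Fin n) ℤ) :
    (matrixEntries M).length = k * n := by
  simp [matrixEntries_eq_ofFn]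

theorem getD_matrixEntries_append {k n : ℕ} (M : Matrix (Fin k) (Fin n) ℤ) (xs : List ℤ)
    (i : Fin k) (j : Fin n) : (matrixEntries M ++ xs).getD (i * n + j) 0 = M i j := by
  have h : (i : ℕ) * n + j < k * n := by
    have h1 := i.isLt
    have h2 := j.isLt
    nlinarith
  rw [List.getD_append _ _ _ _ (by rwa [length_matrixEntries])]
  rw [List.getD_eq_getElem _ _ (by rwa [length_matrixEntries])]
  simp only [matrixEntries_eq_ofFn, List.getElem_ofFn, divNat_mk_mul_add, modNat_mk_mul_add]

theorem matrixEntries_map {k n : ℕ} (M : Matrix (Fin k) (Fin n) ℤ) (f : ℤ → ℤ) :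
    matrixEntries (M.map f) = (matrixEntries M).map f := by
  simp [matrixEntries, List.map_flatten, List.map_ofFn, Function.comp_def]

theorem length_le_bitSize (xs : List ℤ) : xs.length ≤ bitSize xs := by
  induction xs with
  | nil => simp
  | cons x xs ih => simp only [bitSize, List.map_cons, List.sum_cons, List.length_cons] at *; omega

theorem bitLen_le_bitSize {xs : List ℤ} {x : ℤ} (hx : x ∈ xs) : bitLen x ≤ bitSize xs :=
  (Nat.le_add_left _ 1).trans (List.single_le_sum (by simp) _ (List.mem_map_of_mem hx))

theorem initMemory_succ (xs : List ℤ) (i : ℕ) : initMemory xs 0 (i + 1) = xs.getD i 0 := by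
  have h1 : (i : ℤ) + 1 ≠ 0 := by omega
  have h2 : 0 < (i : ℤ) + 1 := by omega
  have h3 : ((i : ℤ) + 1).toNat - 1 = i := by omega
  simp only [initMemory, if_true, h1, h2, h3, if_false]

theorem initMemory_bounded (xs : List ℤ) : (initMemory xs).Bounded (bitSize xs) := by
  intro a i
  unfold initMemory
  split_ifs
  · exact (bitLen_natCast_le _).trans (length_le_bitSize xs)
  · by_cases h : i.toNat - 1 < xs.length
    · rw [List.getD_eq_getElem _ _ h]
      exact bitLen_le_bitSize (List.getElem_mem h)
    · rw [List.getD_eq_default _ _ (not_lt.mp h)]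
      simp [bitLen_zero]
  all_goals simp [bitLen_zero]

/-- A word length that suffices for all computations on inputs of bit size `S`. -/
def wordLength (S : ℕ) : ℕ := 3 * S * S + S + 3

/-- The word length is itself polynomial in the bit size, so the cost estimate of `Prog.Ensures`
becomes a polynomial once `d` is fixed. -/
theorem PolyTimeComputable.of_ensures {X : Type} {enc F : X → List ℤ} (p : Prog) (d : ℕ)
    (h : ∀ x, p.Ensures (wordLength (bitSize (enc x))) d (initMemory (enc x))
      fun s => HasOutput s (F x)) : PolyTimeComputable enc F := by
  refine ⟨p, Polynomial.C p.weight *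
    (3 * Polynomial.X * Polynomial.X + Polynomial.X + 3 + 1) ^ (d + 2), fun x => ?_⟩
  obtain ⟨s, t, hr, ht, -, hq⟩ := h x
  refine ⟨s, t, hr, hq, ht.trans (le_of_eq ?_)⟩
  simp [wordLength]

/-- The entries of the matrix at the beginning of the input. -/
def inputEntry (xs : List ℤ) (n i j : ℕ) : ℤ := initMemory xs 0 (2 + ((i : ℤ) * n + j))

section
variable {n : ℕ} (B : Matrix (Fin n) (Fin n) ℤ) (ys : List ℤ)

theorem initMemory_data (xs : List ℤ) (x : ℤ) (m : ℕ) :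
    initMemory (x :: xs) 0 (2 + m) = xs.getD m 0 := by
  rw [show (2 : ℤ) + m = ((m + 1 : ℕ) : ℤ) + 1 by push_cast; ring, initMemory_succ,
    List.getD_cons_succ]

theorem inputEntry_eq (i j : Fin n) :
    inputEntry ((n : ℤ) :: (matrixEntries B ++ ys)) n i j = B i j := by
  rw [inputEntry, show (i : ℤ) * n + j = ((i * n + j : ℕ) : ℤ) by push_cast; rfl, initMemory_data,
    getD_matrixEntries_append]

theorem dim_lt_bitSize : n < bitSize ((n : ℤ) :: (matrixEntries B ++ ys)) := by
  refine lt_of_lt_of_le ?_ (length_le_bitSize _)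
  simp only [List.length_cons, List.length_append, length_matrixEntries]
  nlinarith [Nat.le_mul_self n]

/-- Both `n + 1` and the entry bound are at most `2 ^ S`, so each of the `n < S` steps adds at most
`3 * S` bits. This is the source of the leading term of `wordLength`. -/
theorem recursion_bound_le {S : ℕ} (hn : n < S) :
    (((n : ℤ) + 1) ^ 2 * 2 ^ S) ^ n ≤ 2 ^ (3 * S * S) := by
  have h1 : (n : ℤ) + 1 ≤ 2 ^ S := by
    exact_mod_cast (Nat.lt_of_lt_of_le hn Nat.lt_two_pow_self.le : n < 2 ^ S)
  calc (((n : ℤ) + 1) ^ 2 * 2 ^ S) ^ n ≤ ((2 ^ S) ^ 2 * 2 ^ S) ^ n := by gcongr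
    _ = 2 ^ (3 * S * n) := by rw [← pow_succ, ← pow_mul, ← pow_mul]; ring_nf
    _ ≤ _ := pow_le_pow_right₀ (by norm_num) (Nat.mul_le_mul_left _ hn.le)

theorem setting_input (xs : List ℤ) (hxs : xs = (n : ℤ) :: (matrixEntries B ++ ys)) :
    DetProg.Setting n (wordLength (bitSize xs)) (initMemory xs 0) (inputEntry xs n)
      (2 ^ bitSize xs) where
  dim := by
    have := initMemory_succ xs 0
    simpa [hxs] using this
  entries _ _ := rfl
  one_le := one_le_pow₀ (by norm_num)
  abs_le i j := (bitLen_le_iff.mp (initMemory_bounded xs _ _)).le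
  dim_le := by
    have := dim_lt_bitSize B ys
    rw [← hxs] at this
    unfold wordLength
    omega
  word x hx := by
    have := dim_lt_bitSize B ys
    rw [← hxs] at this
    rw [bitLen_le_iff]
    refine (hx.trans (recursion_bound_le this)).trans_lt ?_
    exact pow_lt_pow_right₀ (by norm_num) (by unfold wordLength; omega)

theorem ensures_absDet_input (xs : List ℤ) (hxs : xs = (n : ℤ) :: (matrixEntries B ++ ys)) :
    DetProg.absDet.Ensures (wordLength (bitSize xs)) 4 (initMemory xs) fun s =>
      s 0 = initMemory xs 0 ∧ s 2 0 = B.det.natAbs := by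
  have := DetProg.ensures_absDet (setting_input B ys xs hxs) (s := initMemory xs)
    (fun a i => (initMemory_bounded xs a i).trans (by unfold wordLength; omega)) rfl
    (by funext i; simp [initMemory])
  rwa [abs_leverrier (B := B) (by subst hxs; exact inputEntry_eq B ys)] at this

theorem natAbs_det_le (xs : List ℤ) (hxs : xs = (n : ℤ) :: (matrixEntries B ++ ys)) :
    (B.det.natAbs : ℤ) ≤ 2 ^ (3 * bitSize xs * bitSize xs) := by
  have h := setting_input B ys xs hxs
  have hn := dim_lt_bitSize B ys
  rw [← hxs] at hn
  have hA : ∀ i j : Fin n, inputEntry xs n i j = B i j := by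
    subst hxs
    exact inputEntry_eq B ys
  rw [← abs_leverrier hA]
  exact (abs_leverrier_le h.one_le h.abs_le n).2.trans (recursion_bound_le hn)

end

/-! ### The programs of the reduction -/

/-- Computes `|det B|` and reduces the remaining input modulo it. -/
def queryProg : Prog :=
  .seq DetProg.absDet (.seq (.write 1 (.const 0) (.plus (.read 0 (.const 0)) (.const 2)))
    (.seq (.write 1 (.const 1) (.var 2)) (.seq (.write 1 (.const 2) dimTerm)
      (.seq (.write 1 (.const 3) dimTerm)
        (.forLoop 3 (.minus (.read 0 (.const 0)) (.const 1))
          (.write 1 (.plus (.const 4) (.var 3))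
            (.minus (.read 0 (.plus (.const 2) (.var 3)))
              (.times (.var 2) (.quot (.read 0 (.plus (.const 2) (.var 3))) (.var 2))))))))))

/-- The header `n` is replaced by `q, n, n`, so the length grows by two and the data move to the
cells from `4` on. Residues are computed as `a - q * (a / q)`. -/
theorem ensures_queryProg {n : ℕ} (B : Matrix (Fin n) (Fin n) ℤ) (ys : List ℤ)
    (hB : 0 < B.det.natAbs) :
    queryProg.Ensures (wordLength (bitSize ((n : ℤ) :: (matrixEntries B ++ ys)))) 4
      (initMemory ((n : ℤ) :: (matrixEntries B ++ ys))) fun s =>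
        HasOutput s ((B.det.natAbs : ℤ) :: (n : ℤ) :: (n : ℤ) ::
          (matrixEntries B ++ ys).map (· % (B.det.natAbs : ℤ))) := by
  obtain ⟨xs, hxs⟩ : ∃ xs, xs = (n : ℤ) :: (matrixEntries B ++ ys) := ⟨_, rfl⟩
  have hset := setting_input B ys xs hxs
  have hdet := ensures_absDet_input B ys xs hxs
  rw [← hxs]
  generalize hzs : matrixEntries B ++ ys = zs at *
  generalize hq : B.det.natAbs = q at *
  have hlen : xs.length = zs.length + 1 := by simp [hxs]
  have hinp : ∀ m : ℕ, initMemory xs 0 (2 + m) = zs.getD m 0 := fun m => by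
    rw [hxs, initMemory_data]
  have hinp0 : initMemory xs 0 0 = zs.length + 1 := by simp [initMemory, hlen]
  have hlenW : zs.length + 3 ≤ wordLength (bitSize xs) := by
    have := length_le_bitSize xs
    unfold wordLength
    omega
  generalize wordLength (bitSize xs) = W at *
  generalize hI : initMemory xs 0 = inp at *
  refine .seq hdet ?_
  rintro s hs ⟨h0, h2⟩
  refine .seq (R := fun s => s 0 = inp ∧ s 2 0 = q ∧ s 1 0 = zs.length + 3)
    (.write hs _ _ _ ?_ ?_) ?_
  · simp only [Arith.eval, h0, hinp0]
    exact (bitLen_natCast_le (zs.length + 3)).trans hlenW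
  · refine ⟨by rw [Memory.store_of_ne (by decide), h0], ?_⟩
    simp [Memory.store, Arith.eval, h0, hinp0, h2]
    ring
  rintro s hs ⟨h0, h2, h10⟩
  refine .seq (R := fun s => s 0 = inp ∧ s 2 0 = q ∧ s 1 0 = zs.length + 3 ∧ s 1 1 = q)
    (.write hs _ _ _ (hs 2 0) ?_) ?_
  · refine ⟨by rw [Memory.store_of_ne (by decide), h0], ?_⟩
    simp [Memory.store, Arith.eval, h10, h2]
  rintro s hs ⟨h0, h2, h10, h11⟩
  refine .seq (R := fun s => s 0 = inp ∧ s 2 0 = q ∧ s 1 0 = zs.length + 3 ∧ s 1 1 = q ∧ s 1 2 = n)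
    (.write hs _ _ _ (hs 0 1) ?_) ?_
  · refine ⟨by rw [Memory.store_of_ne (by decide), h0], ?_⟩
    simp [Memory.store, Arith.eval, h0, hset.dim, h10, h11, h2]
  rintro s hs ⟨h0, h2, h10, h11, h12⟩
  refine .seq (R := fun s => s 0 = inp ∧ s 2 0 = q ∧ s 1 0 = zs.length + 3 ∧ s 1 1 = q ∧
    s 1 2 = n ∧ s 1 3 = n) (.write hs _ _ _ (hs 0 1) ?_) ?_
  · refine ⟨by rw [Memory.store_of_ne (by decide), h0], ?_⟩
    simp [Memory.store, Arith.eval, h0, hset.dim, h10, h11, h12, h2]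
  rintro s hs ⟨h0, h2, h10, h11, h12, h13⟩
  refine (Prog.Ensures.forLoop (d := 0) (n := zs.length) (fun k s => s 0 = inp ∧ s 2 0 = q ∧
    s 1 0 = zs.length + 3 ∧ s 1 1 = q ∧ s 1 2 = n ∧ s 1 3 = n ∧
    ∀ m : ℕ, m < k → s 1 (4 + m) = zs.getD m 0 % q) (by omega) ?_ ?_ ?_ hs
    ⟨h0, h2, h10, h11, h12, h13, by simp⟩).mono (by omega) ?_
  · intro k s x h
    simpa only [Memory.store_of_ne (by decide : (0 : ℕ) ≠ 3),
      Memory.store_of_ne (by decide : (1 : ℕ) ≠ 3), Memory.store_of_ne (by decide : (2 : ℕ) ≠ 3)]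
      using h
  · intro k s h
    simp [Arith.eval, h.1, hinp0]
  · rintro k s hk hs h3 ⟨h0, h2, h10, h11, h12, h13, h⟩
    have hv : (Arith.minus (.read 0 (.plus (.const 2) (.var 3))) (.times (.var 2)
        (.quot (.read 0 (.plus (.const 2) (.var 3))) (.var 2)))).eval s = zs.getD k 0 % q := by
      simp only [Arith.eval, h0, h2, h3, hinp]
      rw [Int.emod_def]
    have hi : (Arith.plus (.const 4) (.var 3)).eval s = 4 + k := by simp only [Arith.eval, h3]
    refine .write hs _ _ _ ?_ ?_
    · rw [hv]
      refine le_trans (bitLen_mono ?_) (hs 2 0)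
      rw [h2, abs_of_nonneg (Int.emod_nonneg _ (by omega)), Nat.abs_cast]
      exact (Int.emod_lt_of_pos _ (by omega)).le
    · rw [hv, hi]
      simp only [Memory.store_of_ne (by decide : (0 : ℕ) ≠ 1),
        Memory.store_of_ne (by decide : (3 : ℕ) ≠ 1), Memory.store_of_ne (by decide : (2 : ℕ) ≠ 1)]
      refine ⟨h3, h0, h2, ?_, ?_, ?_, ?_, fun m hm => ?_⟩
      · rwa [Memory.store_cell_of_ne (by omega)]
      · rwa [Memory.store_cell_of_ne (by omega)]
      · rwa [Memory.store_cell_of_ne (by omega)]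
      · rwa [Memory.store_cell_of_ne (by omega)]
      · rcases Nat.lt_succ_iff_lt_or_eq.mp hm with hm | rfl
        · rw [Memory.store_cell_of_ne (by omega), h m hm]
        · rw [Memory.store_self]
  · rintro s ⟨h0, h2, h10, h11, h12, h13, h⟩
    refine ⟨by simp [h10]; ring, fun i hi => ?_⟩
    match i, hi with
    | 0, _ => simpa using h11
    | 1, _ => simpa using h12
    | 2, _ => simpa using h13
    | i + 3, hi =>
      have hi' : i < zs.length := by simpa using hi
      have := h i hi'
      rw [List.getD_eq_getElem _ _ hi'] at this
      simp only [List.getD_cons_succ]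
      rw [List.getD_eq_getElem _ _ (by simpa using hi'), List.getElem_map, ← this]
      congr 1
      push_cast
      ring

/-! ### Lifting a residue next to the received vector -/

/-- The integer congruent to `c` modulo `q` that is closest to `r`. -/
def nearestLift (q r c : ℤ) : ℤ := c + q * ((2 * (r - c) + q) / (2 * q))

/-- The quotient `(2 * (r - c) + q) / (2 * q)` is the floor of `(r - c) / q + 1/2`, that is, `(r -
c) / q` rounded to a nearest integer. -/
theorem two_mul_abs_nearestLift_sub_le {q : ℤ} (hq : 0 < q) (r c : ℤ) :
    2 * |nearestLift q r c - r| ≤ q := by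
  have h1 := Int.mul_ediv_add_emod (2 * (r - c) + q) (2 * q)
  have h2 := Int.emod_nonneg (2 * (r - c) + q) (by omega : 2 * q ≠ 0)
  have h3 := Int.emod_lt_of_pos (2 * (r - c) + q) (by omega : 0 < 2 * q)
  unfold nearestLift
  rw [mul_assoc] at h1
  rcases abs_cases (c + q * ((2 * (r - c) + q) / (2 * q)) - r) with h | h <;> omega

/-- Computes `|det B|` and lifts the word at the end of the input to `ℤⁿ`. -/
def answerProg : Prog :=
  .seq DetProg.absDet (.seq (.write 1 (.const 0) dimTerm)
    (.forLoop 3 dimTerm (.write 1 (.plus (.var 3) (.const 1))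
      (.plus (.read 0 (.plus (.const 2) (.plus (.times dimTerm dimTerm)
          (.plus dimTerm (.var 3)))))
        (.times (.var 2) (.quot
          (.plus (.times (.const 2) (.minus
            (.read 0 (.plus (.const 2) (.plus (.times dimTerm dimTerm) (.var 3))))
            (.read 0 (.plus (.const 2) (.plus (.times dimTerm dimTerm)
              (.plus dimTerm (.var 3))))))) (.var 2))
          (.times (.const 2) (.var 2))))))))

theorem ensures_answerProg {n : ℕ} (B : Matrix (Fin n) (Fin n) ℤ) (hB : 0 < B.det.natAbs)
    (r c : Fin n → ℤ) {xs : List ℤ}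
    (hxs : xs = (n : ℤ) :: (matrixEntries B ++ (List.ofFn r ++ List.ofFn c))) :
    answerProg.Ensures (wordLength (bitSize xs)) 4 (initMemory xs) fun s =>
      HasOutput s (List.ofFn fun i => nearestLift B.det.natAbs (r i) (c i)) := by
  have hset := setting_input B _ xs hxs
  have hdet := ensures_absDet_input B _ xs hxs
  have hq := natAbs_det_le B _ xs hxs
  have hr : ∀ i (hi : i < n), initMemory xs 0 (2 + ((n : ℤ) * n + i)) = r ⟨i, hi⟩ := fun i hi => by
    rw [show (n : ℤ) * n + i = ((n * n + i : ℕ) : ℤ) by push_cast; rfl, hxs, initMemory_data,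
      List.getD_append_right _ _ _ _ (by rw [length_matrixEntries]; omega),
      length_matrixEntries, Nat.add_sub_cancel_left, List.getD_append _ _ _ _ (by simpa using hi),
      List.getD_eq_getElem _ _ (by simpa using hi), List.getElem_ofFn]
  have hc : ∀ i (hi : i < n), initMemory xs 0 (2 + ((n : ℤ) * n + (n + i))) = c ⟨i, hi⟩ :=
    fun i hi => by
    rw [show (n : ℤ) * n + (n + i) = ((n * n + (n + i) : ℕ) : ℤ) by push_cast; rfl, hxs,
      initMemory_data, List.getD_append_right _ _ _ _ (by rw [length_matrixEntries]; omega),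
      length_matrixEntries, Nat.add_sub_cancel_left,
      List.getD_append_right _ _ _ _ (by simp), List.length_ofFn, Nat.add_sub_cancel_left,
      List.getD_eq_getElem _ _ (by simpa using hi), List.getElem_ofFn]
  have hword : ∀ i (hi : i < n), bitLen (nearestLift B.det.natAbs (r ⟨i, hi⟩) (c ⟨i, hi⟩)) ≤
      wordLength (bitSize xs) := fun i hi => by
    have h1 := two_mul_abs_nearestLift_sub_le (q := B.det.natAbs) (by omega) (r ⟨i, hi⟩) (c ⟨i, hi⟩)
    have h2 := bitLen_le_iff.mp (initMemory_bounded xs 0 (2 + ((n : ℤ) * n + i)))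
    rw [hr i hi] at h2
    have h3 := abs_add_le (nearestLift B.det.natAbs (r ⟨i, hi⟩) (c ⟨i, hi⟩) - r ⟨i, hi⟩) (r ⟨i, hi⟩)
    rw [sub_add_cancel] at h3
    rw [bitLen_le_iff]
    have h4 : (2 : ℤ) ^ bitSize xs ≤ 2 ^ (3 * bitSize xs * bitSize xs + bitSize xs) :=
      pow_le_pow_right₀ (by norm_num) (by omega)
    have h5 : (2 : ℤ) ^ (3 * bitSize xs * bitSize xs) ≤
        2 ^ (3 * bitSize xs * bitSize xs + bitSize xs) :=
      pow_le_pow_right₀ (by norm_num) (by omega)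
    -- The lift differs from `r` by at most `q / 2`; since `q` and `|r|` are both at most `2 ^ (3S²
    -- + S)`, the three spare bits absorb the sum.
    rw [wordLength, pow_add _ _ 3]
    linarith [abs_nonneg (nearestLift B.det.natAbs (r ⟨i, hi⟩) (c ⟨i, hi⟩) - r ⟨i, hi⟩)]
  generalize hq' : B.det.natAbs = q at *
  generalize wordLength (bitSize xs) = W at *
  generalize initMemory xs 0 = inp at *
  refine .seq hdet ?_
  rintro s hs ⟨h0, h2⟩
  refine .seq (R := fun s => s 0 = inp ∧ s 2 0 = q ∧ s 1 0 = n) (.write hs _ _ _ (hs 0 1) ?_) ?_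
  · refine ⟨by rw [Memory.store_of_ne (by decide), h0], ?_⟩
    simp [Memory.store, Arith.eval, h0, hset.dim, h2]
  rintro s hs ⟨h0, h2, h10⟩
  refine (Prog.Ensures.forLoop (d := 0) (n := n) (fun k s => s 0 = inp ∧ s 2 0 = q ∧
    s 1 0 = n ∧ ∀ i (hi : i < n), i < k → s 1 (i + 1) = nearestLift q (r ⟨i, hi⟩) (c ⟨i, hi⟩))
    hset.dim_le ?_ ?_ ?_ hs ⟨h0, h2, h10, by simp⟩).mono (by omega) ?_
  · intro k s x h
    simpa only [Memory.store_of_ne (by decide : (0 : ℕ) ≠ 3),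
      Memory.store_of_ne (by decide : (1 : ℕ) ≠ 3), Memory.store_of_ne (by decide : (2 : ℕ) ≠ 3)]
      using h
  · intro k s h
    simp [Arith.eval, h.1, hset.dim]
  · rintro k s hk hs h3 ⟨h0, h2, h10, h⟩
    refine .write hs _ _ _ ?_ ?_
    · simp only [Arith.eval, h0, h2, h3, hset.dim, hr k hk, hc k hk]
      exact hword k hk
    · simp only [Arith.eval, h0, h2, h3, hset.dim, hr k hk, hc k hk]
      simp only [Memory.store_of_ne (by decide : (0 : ℕ) ≠ 1),
        Memory.store_of_ne (by decide : (3 : ℕ) ≠ 1), Memory.store_of_ne (by decide : (2 : ℕ) ≠ 1)]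
      refine ⟨h3, h0, h2, ?_, fun i hi hik => ?_⟩
      · rwa [Memory.store_cell_of_ne (by omega)]
      · rcases Nat.lt_succ_iff_lt_or_eq.mp hik with hm | rfl
        · rw [Memory.store_cell_of_ne (by omega), h i hi hm]
        · rw [Memory.store_self, nearestLift]
  · rintro s ⟨h0, h2, h10, h⟩
    refine ⟨by simpa using h10, fun i hi => ?_⟩
    have hi' : i < n := by simpa using hi
    rw [h i hi' hi', List.getD_eq_getElem _ _ hi, List.getElem_ofFn]

/-! ### Lattice points and codewords -/

/-- Reduction of an integer vector modulo `q`. -/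
def modVec (q : ℕ) {n : ℕ} (v : Fin n → ℤ) : Fin n → ZMod q := fun i => v i

theorem modVec_add (q : ℕ) {n : ℕ} (v w : Fin n → ℤ) :
    modVec q (v + w) = modVec q v + modVec q w := by
  funext i
  simp [modVec]

theorem modVec_sub (q : ℕ) {n : ℕ} (v w : Fin n → ℤ) :
    modVec q (v - w) = modVec q v - modVec q w := by
  funext i
  simp [modVec]

theorem modVec_smul (q : ℕ) {n : ℕ} (a : ℤ) (v : Fin n → ℤ) :
    modVec q (a • v) = (a : ZMod q) • modVec q v := by
  funext i
  simp [modVec]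

theorem modVec_eq_zero_iff {q n : ℕ} {v : Fin n → ℤ} :
    modVec q v = 0 ↔ ∃ w : Fin n → ℤ, v = (q : ℤ) • w := by
  constructor
  · intro h
    have : ∀ i, ∃ w : ℤ, v i = q * w := fun i =>
      (ZMod.intCast_zmod_eq_zero_iff_dvd _ _).mp (congrFun h i)
    choose w hw using this
    exact ⟨w, funext hw⟩
  · rintro ⟨w, rfl⟩
    funext i
    simp [modVec]

namespace LatticeBasis

variable (L : LatticeBasis)

/-- `det B • v = (v * adj B) * B` is an integral combination of the rows of `B`. -/
theorem natAbs_det_smul_mem (v : Fin L.n → ℤ) : (L.basis.det.natAbs : ℤ) • v ∈ L.lattice := by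
  have h : L.basis.det • v ∈ L.lattice := by
    have h1 : L.basis.det • v = Matrix.vecMul (Matrix.vecMul v L.basis.adjugate) L.basis := by
      rw [Matrix.vecMul_vecMul, Matrix.adjugate_mul, Matrix.vecMul_smul, Matrix.vecMul_one]
    rw [h1, Matrix.vecMul_eq_sum]
    exact Submodule.sum_mem _ fun i _ =>
      Submodule.smul_mem _ _ (Submodule.subset_span ⟨i, rfl⟩)
  rcases Int.natAbs_eq L.basis.det with h0 | h0
  · rwa [← h0]
  · rw [show (L.basis.det.natAbs : ℤ) = -L.basis.det by omega, neg_smul]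
    exact Submodule.neg_mem _ h

theorem modVec_mem_words {v : Fin L.n → ℤ} (hv : v ∈ L.lattice) :
    modVec L.basis.det.natAbs v ∈ L.code.words := by
  induction hv using Submodule.span_induction with
  | mem v hv =>
    obtain ⟨i, rfl⟩ := hv
    exact Submodule.subset_span ⟨i, rfl⟩
  | zero =>
    rw [show modVec L.basis.det.natAbs (0 : Fin L.n → ℤ) = 0 from modVec_eq_zero_iff.mpr ⟨0, by simp⟩]
    exact Submodule.zero_mem _
  | add v w _ _ hv hw =>
    rw [modVec_add]
    exact Submodule.add_mem _ hv hw
  | smul a v _ hv =>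
    rw [modVec_smul]
    exact Submodule.smul_mem _ _ hv

theorem exists_modVec_eq_of_mem_words {c : Fin L.code.n → ZMod L.code.q}
    (hc : c ∈ L.code.words) : ∃ v ∈ L.lattice, modVec L.basis.det.natAbs v = c := by
  induction hc using Submodule.span_induction with
  | mem v hv =>
    obtain ⟨i, rfl⟩ := hv
    exact ⟨L.basis i, Submodule.subset_span ⟨i, rfl⟩, rfl⟩
  | zero => exact ⟨0, Submodule.zero_mem _, modVec_eq_zero_iff.mpr ⟨0, by simp⟩⟩
  | add v w _ _ hv hw =>
    obtain ⟨v', hv', rfl⟩ := hv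
    obtain ⟨w', hw', rfl⟩ := hw
    exact ⟨v' + w', Submodule.add_mem _ hv' hw', modVec_add _ _ _⟩
  | smul a v _ hv =>
    obtain ⟨v', hv', rfl⟩ := hv
    obtain ⟨b, rfl⟩ := ZMod.intCast_surjective a
    exact ⟨b • v', Submodule.smul_mem _ _ hv', modVec_smul _ _ _⟩

/-- The lattice contains `q ℤⁿ`, so membership depends only on the residue, and every codeword is
the residue of some lattice vector. -/
theorem mem_lattice_of_modVec_mem_words {v : Fin L.n → ℤ}
    (hv : modVec L.basis.det.natAbs v ∈ L.code.words) : v ∈ L.lattice := by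
  obtain ⟨u, hu, h⟩ := L.exists_modVec_eq_of_mem_words hv
  obtain ⟨w, hw⟩ : ∃ w : Fin L.n → ℤ, v - u = (L.basis.det.natAbs : ℤ) • w := by
    rw [← modVec_eq_zero_iff, modVec_sub, h, sub_self]
  rw [← sub_add_cancel v u, hw]
  exact Submodule.add_mem _ (L.natAbs_det_smul_mem w) hu

theorem exists_l1Norm_sub_lt {r : Fin L.n → ℤ} {t : ℝ} (h : L.dist r < t) :
    ∃ v ∈ L.lattice, l1Norm (r - v) < t := by
  obtain ⟨d, ⟨v, hv, rfl⟩, hd⟩ :=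
    exists_lt_of_csInf_lt (s := {d : ℝ | ∃ v ∈ L.lattice, d = l1Norm (r - v)})
      ⟨l1Norm (r - 0), 0, Submodule.zero_mem _, rfl⟩ h
  exact ⟨v, hv, hd⟩

end LatticeBasis

/-! ### Comparison of the `ℓ₁`-norm with the Lee weight -/

theorem l1Norm_nonneg {n : ℕ} (v : Fin n → ℤ) : 0 ≤ l1Norm v :=
  Finset.sum_nonneg fun _ _ => abs_nonneg _

theorem l1Norm_add_le {n : ℕ} (v w : Fin n → ℤ) : l1Norm (v + w) ≤ l1Norm v + l1Norm w := by
  simp only [l1Norm, ← Finset.sum_add_distrib, Pi.add_apply, Int.cast_add]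
  exact Finset.sum_le_sum fun i _ => abs_add_le _ _

theorem LatticeBasis.lambda1_le (L : LatticeBasis) {v : Fin L.n → ℤ} (hv : v ∈ L.lattice)
    (h0 : v ≠ 0) : L.lambda1 ≤ l1Norm v :=
  csInf_le ⟨0, by rintro _ ⟨v, -, -, rfl⟩; exact l1Norm_nonneg v⟩ ⟨v, hv, h0, rfl⟩

/-- For a nonnegative quotient the remainder is at most `w`; for a quotient at most `-1`, its
complement to `q` is at most `-w`. -/
theorem min_emod_le_abs {q : ℤ} (hq : 0 < q) (w : ℤ) : min (w % q) (q - w % q) ≤ |w| := by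
  have h1 := Int.mul_ediv_add_emod w q
  have h2 := Int.emod_nonneg w hq.ne'
  rcases le_or_gt 0 (w / q) with h | h
  · refine (min_le_left _ _).trans ((?_ : w % q ≤ w).trans (le_abs_self w))
    nlinarith
  · refine (min_le_right _ _).trans ((?_ : q - w % q ≤ -w).trans (neg_le_abs w))
    nlinarith

theorem abs_le_min_emod {q e : ℤ} (he : 2 * |e| ≤ q) :
    |e| ≤ min (e % q) (q - e % q) := by
  rcases le_or_gt 0 e with h | h
  · rw [abs_of_nonneg h] at *
    -- For `e = 0` the modulus may be `0` as well, and `e < q` is not available.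
    rcases h.eq_or_lt with rfl | h'
    · simpa using he
    · rw [Int.emod_eq_of_lt h (by omega)]
      exact le_min le_rfl (by omega)
  · rw [abs_of_neg h] at *
    rw [show e % q = e + q by
      rw [← Int.add_emod_right, Int.emod_eq_of_lt (by omega) (by omega)]]
    exact le_min (by omega) (by omega)

theorem leeWeight_modVec {q n : ℕ} (hq : 0 < q) (w : Fin n → ℤ) :
    (leeWeight (modVec q w) : ℝ) =
      ∑ i, ((min (w i % q) (q - w i % q) : ℤ) : ℝ) := by
  have : NeZero q := ⟨hq.ne'⟩
  simp only [leeWeight, modVec, Nat.cast_sum]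
  refine Finset.sum_congr rfl fun i _ => ?_
  rw [← Int.cast_natCast, ← ZMod.val_intCast, Nat.cast_min,
    Nat.cast_sub (ZMod.val_lt _).le]

theorem leeWeight_modVec_le {q n : ℕ} (hq : 0 < q) (w : Fin n → ℤ) :
    (leeWeight (modVec q w) : ℝ) ≤ l1Norm w := by
  rw [leeWeight_modVec hq]
  refine Finset.sum_le_sum fun i _ => ?_
  exact_mod_cast min_emod_le_abs (by omega : (0 : ℤ) < q) (w i)

theorem l1Norm_le_leeWeight {q n : ℕ} (hq : 0 < q) {w : Fin n → ℤ} (hw : ∀ i, 2 * |w i| ≤ q) :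
    l1Norm w ≤ leeWeight (modVec q w) := by
  rw [leeWeight_modVec hq]
  refine Finset.sum_le_sum fun i _ => ?_
  exact_mod_cast abs_le_min_emod (hw i)

/-! ### The reduction -/

/-- The query for the instance `(L, r)`: the code of `L` and `r` modulo `|det B|`. -/
def leeQuery (x : BDDInstance) : LeeInstance where
  C := x.L.code
  r := modVec x.L.basis.det.natAbs x.r

/-- Lifts a codeword to the integer vector closest to the received vector. -/
def liftAnswer (x : BDDInstance) (y : Fin x.L.n → ZMod x.L.basis.det.natAbs) : Fin x.L.n → ℤ :=
  fun i => nearestLift x.L.basis.det.natAbs (x.r i) ((y i).val : ℤ)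

theorem entries_mod {q k n : ℕ} (hq : 0 < q) (M : Matrix (Fin k) (Fin n) ℤ) (r : Fin n → ℤ) :
    matrixEntries ((M.map fun a => (a : ZMod q)).map fun a => (a.val : ℤ)) ++
      List.ofFn (fun i => ((modVec q r i).val : ℤ)) =
      (matrixEntries M ++ List.ofFn r).map (· % (q : ℤ)) := by
  have : NeZero q := ⟨hq.ne'⟩
  have h : ((M.map fun a => (a : ZMod q)).map fun a => (a.val : ℤ)) = M.map (· % (q : ℤ)) := by
    ext i j
    exact ZMod.val_intCast _
  simp only [h, matrixEntries_map, List.map_append, List.map_ofFn, modVec, ZMod.val_intCast,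
    Function.comp_def]

theorem encInst_leeQuery (x : BDDInstance) : leeFormat.encInst (leeQuery x) =
    (x.L.basis.det.natAbs : ℤ) :: (x.L.n : ℤ) :: (x.L.n : ℤ) ::
      (matrixEntries x.L.basis ++ List.ofFn x.r).map (· % (x.L.basis.det.natAbs : ℤ)) :=
  congrArg (fun l => (x.L.basis.det.natAbs : ℤ) :: (x.L.n : ℤ) :: (x.L.n : ℤ) :: l)
    (entries_mod x.L.natAbs_det_pos x.L.basis x.r)

theorem modVec_liftAnswer (x : BDDInstance) (y : Fin x.L.n → ZMod x.L.basis.det.natAbs) :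
    modVec x.L.basis.det.natAbs (liftAnswer x y) = y := by
  have : NeZero x.L.basis.det.natAbs := ⟨x.L.natAbs_det_pos.ne'⟩
  funext i
  simp [modVec, liftAnswer, nearestLift, -Nat.cast_natAbs]

/-- The reduction from bounded distance decoding to Lee decoding. -/
def bddToLee : PolyTimeReduction bddFormat leeFormat where
  query := leeQuery
  answer := liftAnswer
  query_polyTime := .of_ensures queryProg 4 fun x =>
    (ensures_queryProg x.L.basis (List.ofFn x.r) x.L.natAbs_det_pos).mono le_rfl
      fun _ h => (encInst_leeQuery x).symm ▸ h
  answer_polyTime := .of_ensures answerProg 4 fun z =>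
    ensures_answerProg z.1.L.basis z.1.L.natAbs_det_pos z.1.r (fun i => ((z.2 i).val : ℤ)) (by
      change (z.1.L.n : ℤ) :: (matrixEntries z.1.L.basis ++ List.ofFn z.1.r) ++ _ = _
      rw [List.cons_append, List.append_assoc]
      rfl)

section
variable (x : BDDInstance)

theorem leeWeight_query_sub_le {v : Fin x.L.n → ℤ} :
    (leeWeight (modVec x.L.basis.det.natAbs x.r - modVec x.L.basis.det.natAbs v) : ℝ) ≤ l1Norm (x.r - v) := by
  have := leeWeight_modVec_le x.L.natAbs_det_pos (x.r - v)
  rwa [modVec_sub] at this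

/-- The choice of the nearest lift puts all entries of the difference into the range `|e| ≤ q / 2`,
where passing to the Lee weight loses nothing. -/
theorem l1Norm_liftAnswer_sub_le (y : Fin x.L.n → ZMod x.L.basis.det.natAbs) :
    l1Norm (liftAnswer x y - x.r) ≤ leeWeight (modVec x.L.basis.det.natAbs x.r - y) := by
  have hq : (0 : ℤ) < x.L.basis.det.natAbs := by exact_mod_cast x.L.natAbs_det_pos
  have h := l1Norm_le_leeWeight x.L.natAbs_det_pos (w := x.r - liftAnswer x y) fun i => by
    rw [Pi.sub_apply, abs_sub_comm]
    exact two_mul_abs_nearestLift_sub_le hq _ _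
  rw [modVec_sub, modVec_liftAnswer] at h
  refine le_trans (le_of_eq ?_) h
  simp only [l1Norm, Pi.sub_apply, Int.cast_sub, abs_sub_comm]

theorem liftAnswer_mem_lattice {y : Fin x.L.n → ZMod x.L.basis.det.natAbs}
    (hy : y ∈ x.L.code.words) : liftAnswer x y ∈ x.L.lattice :=
  x.L.mem_lattice_of_modVec_mem_words (by rwa [modVec_liftAnswer])

end

theorem bddToLee_strict (α : ℝ) (L : LatticeBasis) :
    bddToLee.ReducesOn {x : BDDInstance | x.L = L} (BDD α) (LeeDPStrict (α * L.lambda1)) := by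
  rintro (x : BDDInstance) rfl hx
  obtain ⟨v, hv, hlt⟩ := x.L.exists_l1Norm_sub_lt hx
  refine ⟨⟨_, x.L.modVec_mem_words hv, (leeWeight_query_sub_le x).trans_lt hlt⟩, ?_⟩
  rintro (y : Fin x.L.n → ZMod x.L.basis.det.natAbs) ⟨hy, hyt⟩
  exact ⟨liftAnswer_mem_lattice x hy, (l1Norm_liftAnswer_sub_le x y).trans_lt hyt⟩

theorem bddToLee_nonstrict (α : ℝ) (L : LatticeBasis)
    (h : α ≤ 1 / 2 ∨ ∀ m : ℤ, α * L.lambda1 ≠ m) :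
    bddToLee.ReducesOn {x : BDDInstance | x.L = L} (BDD α) (LeeDP (α * L.lambda1)) := by
  rintro (x : BDDInstance) rfl hx
  obtain ⟨v, hv, hlt⟩ := x.L.exists_l1Norm_sub_lt hx
  refine ⟨⟨_, x.L.modVec_mem_words hv, ((leeWeight_query_sub_le x).trans_lt hlt).le⟩, ?_⟩
  rintro (y : Fin x.L.n → ZMod x.L.basis.det.natAbs) ⟨hy, hyt⟩
  refine ⟨liftAnswer_mem_lattice x hy, ?_⟩
  change (leeWeight (modVec x.L.basis.det.natAbs x.r - y) : ℝ) ≤ α * x.L.lambda1 at hyt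
  change l1Norm (liftAnswer x y - x.r) < α * x.L.lambda1
  have hle := l1Norm_liftAnswer_sub_le x y
  rcases h with h | h
  -- The unknown close point `v` is strictly within `t` of `r`, which makes the sum strict although
  -- the answer is only known to be within `≤ t`.
  · have hsum : l1Norm (liftAnswer x y - v) < 2 * (α * x.L.lambda1) := by
      have h1 := l1Norm_add_le (liftAnswer x y - x.r) (x.r - v)
      rw [sub_add_sub_cancel] at h1
      linarith
    have heq : liftAnswer x y = v := by
      by_contra hne
      have h1 := x.L.lambda1_le (Submodule.sub_mem _ (liftAnswer_mem_lattice x hy) hv)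
        (sub_ne_zero.mpr hne)
      -- The sign is needed to pass from `α ≤ 1 / 2` to `2 * α * λ₁ ≤ λ₁`.
      have h2 : 0 ≤ x.L.lambda1 := Real.sInf_nonneg (by
        rintro _ ⟨v, -, -, rfl⟩
        exact l1Norm_nonneg v)
      nlinarith
    rw [heq]
    refine lt_of_eq_of_lt ?_ hlt
    simp only [l1Norm, Pi.sub_apply, Int.cast_sub, abs_sub_comm]
  -- The Lee weight is an integer, so equality would make `t` an integer.
  · refine hle.trans_lt (lt_of_le_of_ne hyt fun h0 =>
      h (leeWeight (modVec x.L.basis.det.natAbs x.r - y)) ?_)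
    rw [Int.cast_natCast]
    exact h0.symm

theorem mainTheorem2 :
    ∃ R : PolyTimeReduction bddFormat leeFormat,
      (∀ x : BDDInstance, (R.query x).C = x.L.code) ∧
      ∀ α : ℝ, 0 < α → α < 1 → ∀ L : LatticeBasis,
        R.ReducesOn {x : BDDInstance | x.L = L} (BDD α) (LeeDPStrict (α * L.lambda1)) ∧
        ((α ≤ 1 / 2 ∨ ∀ m : ℤ, α * L.lambda1 ≠ m) →
          R.ReducesOn {x : BDDInstance | x.L = L} (BDD α) (LeeDP (α * L.lambda1))) :=
  ⟨bddToLee, fun _ => rfl, fun α _ _ L => ⟨bddToLee_strict α L, bddToLee_nonstrict α L⟩⟩
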